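/- **Definitions.** A real matrix $S$ is a *slack matrix* of a polytope $P\subseteq\mathbb R^d$ if there is a description $P=\operatorname{conv}\{v_1,\dots,v_n\}=\{x : Ax\le b,\ A^{=}x=b^{=}\}$, where $v_1,\dots,v_n$ are the (distinct) vertices of $P$, such that $S_{ij}=b_i-A_iv_j$ for all $i,j$. A *special row* of a matrix is a $0/1$ row in which both values occur. Let $x_1$ be a special row of $S_1$ and $\overline y_1$ a special row of $S_2$. The *2-product* $(S_1,x_1)\otimes_2(S_2,\overline y_1)$ is the matrix with one column for every pair $(c_1,c_2)$ consisting of a column of $S_1$ and a column of $S_2$ whose special entries agree; this column consists of the non-special entries of $c_1$, the non-special entries of $c_2$, and the common special entry. For matrices, equality with a 2-product is understood up to permuting rows and columns. Matroids are finite, and the *base polytope* $B(M)\subseteq\mathbb R^E$ of a matroid $M$ on $E$ is the convex hull of the characteristic vectors of its bases. $M$ is *connected* if it is not the direct sum of two matroids with non-empty ground sets. For matroids $M_1,M_2$ whose ground sets $E_1',E_2'$ meet in a single element $p$ that is neither a loop nor a coloop of $M_1$ or of $M_2$, the *2-sum* $M_1\oplus_2M_2$ is the matroid on $(E_1'\cup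 E_2')\setminus\{p\}$ with bases $(B_1\cup B_2)\setminus\{p\}$, where $B_i$ is a basis of $M_i$ for $i=1,2$ and $p\in B_1\triangle B_2$. **Lemma.** Let $M$ be a connected matroid and let $S$ be a slack matrix of $B(M)$. Assume that $S=(S_1,x_1)\otimes_2(S_2,\overline y_1)$ for some real matrices $S_1,S_2$ with special rows $x_1,\overline y_1$ respectively. Let $S_1'$ be the matrix obtained from $S_1$ by appending the row $\mathbf 1-x_1$, and let $S_2'$ be the matrix obtained from $S_2$ by appending the row $\mathbf 1-\overline y_1$. Then there are matroids $M_1,M_2$ such that $M=M_1\oplus_2M_2$ and $S_i'$ is a slack matrix of $B(M_i)$ for $i=1,2$. -/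

import Mathlib

namespace TwoProd

/-- `S` is a slack matrix of the polytope `P`: `P` is the convex hull of the points `v j`, which are
its vertices, listed without repetition; `P` is the solution set of the inequalities `A i x ≤ b i`
together with finitely many equations `C l x = d l`; and `S i j` is the slack of the vertex `v j`
in the `i`-th inequality. -/
def IsSlackMatrix {ι κ V : Type*} [AddCommGroup V] [Module ℝ V]
    (S : Matrix ι κ ℝ) (P : Set V) : Prop :=
  ∃ (A : ι → V →ₗ[ℝ] ℝ) (b : ι → ℝ) (k : ℕ) (C : Fin k → V →ₗ[ℝ] ℝ) (d : Fin k → ℝ) (v : κ → V),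
    Function.Injective v ∧
    Set.range v = P.extremePoints ℝ ∧
    P = convexHull ℝ (Set.range v) ∧
    P = {x | (∀ i, A i x ≤ b i) ∧ ∀ l, C l x = d l} ∧
    ∀ i j, S i j = b i - A i (v j)

/-- Two matrices are isomorphic if they agree up to permuting rows and columns. -/
def MatrixIso {ι κ ι' κ' : Type*} (S : Matrix ι κ ℝ) (T : Matrix ι' κ' ℝ) : Prop :=
  ∃ (e : ι ≃ ι') (f : κ ≃ κ'), S = T.submatrix e f

/-- The row `x` is a special row of `S`: its entries are `0` and `1`, and both occur. -/
def IsSpecialRow {ι κ : Type*} (S : Matrix ι κ ℝ) (x : ι) : Prop :=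
  (∀ j, S x j = 0 ∨ S x j = 1) ∧ (∃ j, S x j = 0) ∧ ∃ j, S x j = 1

/-- The 2-product `(S₁, x) ⊗₂ (S₂, y)`. Its columns are the pairs of a column of `S₁` and a column
of `S₂` that both have special entry `0` (the block `S₁[0] ⊗ S₂[0]`) or both have special entry `1`
(the block `S₁[1] ⊗ S₂[1]`). Its rows are the non-special rows of `S₁`, the non-special rows of
`S₂`, and one special row. -/
def twoProduct {ι₁ κ₁ ι₂ κ₂ : Type*} (S₁ : Matrix ι₁ κ₁ ℝ) (x : ι₁) (S₂ : Matrix ι₂ κ₂ ℝ) (y : ι₂) :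
    Matrix (({i : ι₁ // i ≠ x} ⊕ {i : ι₂ // i ≠ y}) ⊕ Unit)
      {c : κ₁ × κ₂ // S₁ x c.1 = S₂ y c.2} ℝ :=
  fun i c =>
    match i with
    | Sum.inl (Sum.inl i) => S₁ i c.1.1
    | Sum.inl (Sum.inr i) => S₂ i c.1.2
    | Sum.inr _ => S₁ x c.1.1

/-- `S = (S₁, x) ⊗₂ (S₂, y)` up to isomorphism, where `x` and `y` are special rows. -/
def IsTwoProduct {ι κ ι₁ κ₁ ι₂ κ₂ : Type*} (S : Matrix ι κ ℝ)
    (S₁ : Matrix ι₁ κ₁ ℝ) (x : ι₁) (S₂ : Matrix ι₂ κ₂ ℝ) (y : ι₂) : Prop :=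
  IsSpecialRow S₁ x ∧ IsSpecialRow S₂ y ∧ MatrixIso S (twoProduct S₁ x S₂ y)

/-- The matrix `S + (𝟏 - x)`: the row `𝟏 - x` is appended to `S`, where `x` is a row of `S`. -/
def addComplRow {ι κ : Type*} (S : Matrix ι κ ℝ) (x : ι) : Matrix (ι ⊕ Unit) κ ℝ :=
  Matrix.fromRows S (Matrix.replicateRow Unit fun j => 1 - S x j)

/-- The base polytope `B(M) ⊆ ℝ^E`, the convex hull of the characteristic vectors of the bases. -/
def basePolytope {α : Type*} (M : Matroid α) : Set (M.E → ℝ) :=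
  convexHull ℝ {z | ∃ B, M.IsBase B ∧ z = fun e : M.E => B.indicator (fun _ => (1 : ℝ)) (e : α)}

/-- A (finite) matroid is connected if it is not the 1-sum (direct sum) of two matroids with
non-empty ground sets, each with fewer elements. -/
def IsConnected {α : Type*} (M : Matroid α) : Prop :=
  ¬ ∃ (M₁ M₂ : Matroid α) (h : Disjoint M₁.E M₂.E),
    M₁.E.Nonempty ∧ M₂.E.Nonempty ∧ M₁.E.ncard < M.E.ncard ∧ M₂.E.ncard < M.E.ncard ∧
      M = M₁.disjointSum M₂ h

/-- `N` is the 2-sum `M₁ ⊕₂ M₂`, whose ground sets meet in the single element `p`. -/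
def IsTwoSum {β : Type*} (N M₁ M₂ : Matroid β) (p : β) : Prop :=
  M₁.E ∩ M₂.E = {p} ∧
  ¬ M₁.IsLoop p ∧ ¬ M₁.IsColoop p ∧ ¬ M₂.IsLoop p ∧ ¬ M₂.IsColoop p ∧
  N.E = (M₁.E ∪ M₂.E) \ {p} ∧
  ∀ B, N.IsBase B ↔ ∃ B₁ B₂, M₁.IsBase B₁ ∧ M₂.IsBase B₂ ∧ p ∈ symmDiff B₁ B₂ ∧
    B = (B₁ ∪ B₂) \ {p}

end TwoProd

/-!
A base `B` corresponds to a pair of columns, one of `S₁` and one of `S₂`, with the same special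
entry. As `M` is connected, this entry is `k - |B ∩ A|` for some set `A` and some constant `k`. An
exchange of `i` for `j` on one side of `A` does not change it, and then it does not change the
column of `S₁` or it does not change the column of `S₂`: otherwise two further bases would have the
same sum as `B` and the exchanged base. Hence `e_j - e_i` lies in one of two subspaces that meet in
`0`, and which one depends on the side only.

If the two sides of `A` belong to different factors, bases with the same special entry can swap
their parts in `A`, which makes `A` a 2-separation of `M`. If both sides belong to the same factor,
the special row of the other factor is injective, and `M` is the 2-sum of a copy of itself and the
uniform matroid of rank 1 on two elements.
-/

namespace TwoProd

open Set Matroid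

section Circuits

variable {α : Type*} {M : Matroid α} {C C₁ C₂ : Set α} {i j x y z : α}

theorem exists_isCircuit_subset_union_sdiff_singleton (h₁ : M.IsCircuit C₁) (h₂ : M.IsCircuit C₂)
    (hy₁ : y ∈ C₁) (hy₂ : y ∈ C₂) (hx₁ : x ∈ C₁) (hx₂ : x ∉ C₂) :
    ∃ C ⊆ (C₁ ∪ C₂) \ {y}, M.IsCircuit C ∧ x ∈ C ∧ (C ∩ (C₂ \ C₁)).Nonempty := by
  obtain ⟨C, hCs, hC, hxC⟩ := h₁.strong_elimination h₂ hy₁ hy₂ hx₁ hx₂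
  refine ⟨C, hCs, hC, hxC, ?_⟩
  by_contra hne
  have hCC₁ : C ⊆ C₁ := fun u hu => by
    by_contra hu₁
    exact hne ⟨u, hu, (hCs hu).1.resolve_left hu₁, hu₁⟩
  have hyC : y ∈ C := hC.eq_of_subset_isCircuit h₁ hCC₁ ▸ hy₁
  exact (hCs hyC).2 rfl

theorem exists_isCircuit_of_inter_nonempty [M.Finite] (h₁ : M.IsCircuit C₁)
    (h₂ : M.IsCircuit C₂) (hx : x ∈ C₁) (hz : z ∈ C₂) (hne : (C₁ ∩ C₂).Nonempty) :
    ∃ C, M.IsCircuit C ∧ x ∈ C ∧ z ∈ C := by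
  induction hn : (C₁ ∪ C₂).ncard using Nat.strong_induction_on generalizing C₁ C₂ with
  | _ n ih =>
  subst hn
  obtain ⟨y, hy₁, hy₂⟩ := hne
  by_cases hx₂ : x ∈ C₂
  · exact ⟨C₂, h₂, hx₂, hz⟩
  by_cases hz₁ : z ∈ C₁
  · exact ⟨C₁, h₁, hx, hz₁⟩
  have hfin : (C₁ ∪ C₂).Finite :=
    M.ground_finite.subset (union_subset h₁.subset_ground h₂.subset_ground)
  obtain ⟨C₃, h₃s, h₃, hx₃, u, hu₃, hu₂, -⟩ :=
    exists_isCircuit_subset_union_sdiff_singleton h₁ h₂ hy₁ hy₂ hx hx₂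
  obtain ⟨C₄, h₄s, h₄, hz₄, w, hw₄, hw₁, hw₂⟩ :=
    exists_isCircuit_subset_union_sdiff_singleton h₂ h₁ hy₂ hy₁ hz hz₁
  rw [union_comm] at h₄s
  have h₃s' := h₃s.trans sdiff_subset
  by_cases hw₃ : w ∈ C₃
  · have hlt : (C₃ ∪ C₄).ncard < (C₁ ∪ C₂).ncard :=
      (ncard_le_ncard (union_subset h₃s h₄s) hfin.sdiff).trans_lt
        (ncard_sdiff_singleton_lt_of_mem (Or.inl hy₁) hfin)
    exact ih _ hlt h₃ h₄ hx₃ hz₄ ⟨w, hw₃, hw₄⟩ rfl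
  · have hlt : (C₃ ∪ C₂).ncard < (C₁ ∪ C₂).ncard :=
      ncard_lt_ncard ⟨union_subset h₃s' subset_union_right,
        fun h => (h (Or.inl hw₁)).elim hw₃ hw₂⟩ hfin
    exact ih _ hlt h₃ h₂ hx₃ hz ⟨u, hu₃, hu₂⟩ rfl

theorem eq_disjointSum_of_forall_isCircuit {X : Set α} (hX : X ⊆ M.E)
    (hC : ∀ C, M.IsCircuit C → C ⊆ X ∨ Disjoint C X) :
    M = (M ↾ X).disjointSum (M ↾ (M.E \ X)) (by simpa using disjoint_sdiff_right) := by
  refine ext_indep (by simp [union_sdiff_cancel hX]) fun I hI => ?_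
  simp only [disjointSum_indep_iff, restrict_indep_iff, restrict_ground_eq, union_sdiff_cancel hX,
    inter_subset_right, and_true, hI]
  refine ⟨fun h => ⟨h.inter_right _, h.inter_right _⟩, fun ⟨h₁, h₂⟩ => ?_⟩
  by_contra hdep
  obtain ⟨C, hCI, hCc⟩ := ((not_indep_iff hI).1 hdep).exists_isCircuit_subset
  rcases hC C hCc with h | h
  · exact hCc.dep.not_indep (h₁.subset (subset_inter hCI h))
  · exact hCc.dep.not_indep (h₂.subset (subset_inter hCI (subset_sdiff.2 ⟨hCc.subset_ground, h⟩)))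

theorem IsConnected.exists_isCircuit [M.Finite] (hM : IsConnected M) (hi : i ∈ M.E)
    (hj : j ∈ M.E) (hij : i ≠ j) : ∃ C, M.IsCircuit C ∧ i ∈ C ∧ j ∈ C := by
  by_contra! hno
  let X : Set α := {k | k ∈ M.E ∧ (k = i ∨ ∃ C, M.IsCircuit C ∧ i ∈ C ∧ k ∈ C)}
  have hXE : X ⊆ M.E := fun k hk => hk.1
  have hiX : i ∈ X := ⟨hi, Or.inl rfl⟩
  have hjX : j ∉ X := by
    rintro ⟨-, h | ⟨C, hC, h₁, h₂⟩⟩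
    · exact hij h.symm
    · exact hno C hC h₁ h₂
  refine hM ⟨M ↾ X, M ↾ (M.E \ X), _, ⟨i, hiX⟩, ⟨j, hj, hjX⟩, ?_, ?_,
    eq_disjointSum_of_forall_isCircuit hXE fun C hC => ?_⟩
  · exact ncard_lt_ncard ⟨hXE, fun h => hjX (h hj)⟩ M.ground_finite
  · exact ncard_lt_ncard ⟨sdiff_subset, fun h => (h hi).2 hiX⟩ M.ground_finite
  · refine or_iff_not_imp_right.2 fun hmeet l hl => ⟨hC.subset_ground hl, Or.inr ?_⟩
    obtain ⟨k, hkC, -, rfl | ⟨C', hC', hiC', hkC'⟩⟩ := not_disjoint_iff.1 hmeet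
    · exact ⟨C, hC, hkC, hl⟩
    · exact exists_isCircuit_of_inter_nonempty hC' hC hiC' hl ⟨k, hkC', hkC⟩

/-- The base exchange `B ↦ B - i + j`: both `B` and `insert j (B \ {i})` are bases of `M`. -/
structure IsExchange (M : Matroid α) (B : Set α) (i j : α) : Prop where
  isBase : M.IsBase B
  mem : i ∈ B
  notMem : j ∉ B
  isBase_exchange : M.IsBase (insert j (B \ {i}))

variable {B : Set α}

theorem IsExchange.ne (h : IsExchange M B i j) : i ≠ j := fun hij => h.notMem (hij ▸ h.mem)

theorem IsExchange.insert_sdiff_cancel (h : IsExchange M B i j) :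
    insert i (insert j (B \ {i}) \ {j}) = B := by
  have := h.mem
  have := h.notMem
  ext e
  simp only [mem_insert_iff, mem_sdiff, mem_singleton_iff]
  grind

theorem IsExchange.symm (h : IsExchange M B i j) : IsExchange M (insert j (B \ {i})) j i where
  isBase := h.isBase_exchange
  mem := mem_insert _ _
  notMem := by simp [h.ne]
  isBase_exchange := by rw [h.insert_sdiff_cancel]; exact h.isBase

theorem exists_isExchange_of_isCircuit (hC : M.IsCircuit C) (hi : i ∈ C) (hj : j ∈ C)
    (hij : i ≠ j) : ∃ B, IsExchange M B i j := by
  obtain ⟨B, hB, hCB⟩ := (hC.sdiff_singleton_indep hj).exists_isBase_superset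
  have hsub : C ⊆ insert j B := by rwa [← sdiff_singleton_subset_iff]
  have hjB : j ∉ B := fun h => hC.dep.not_indep (hB.indep.subset (insert_eq_of_mem h ▸ hsub))
  have hfund : i ∈ M.fundCircuit j B := hC.eq_fundCircuit_of_subset hB.indep hsub ▸ hi
  have hjcl : j ∈ M.closure B := hB.closure_eq ▸ hC.subset_ground hj
  refine ⟨B, hB, hCB ⟨hi, hij⟩, hjB, hB.exchange_isBase_of_indep hjB ?_⟩
  rw [insert_sdiff_singleton_comm hij.symm]
  exact (hB.indep.mem_fundCircuit_iff hjcl hjB).1 hfund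

theorem IsConnected.exists_isExchange [M.Finite] (hM : IsConnected M) (hi : i ∈ M.E)
    (hj : j ∈ M.E) (hij : i ≠ j) : ∃ B, IsExchange M B i j :=
  let ⟨_, hC, hiC, hjC⟩ := hM.exists_isCircuit hi hj hij
  exists_isExchange_of_isCircuit hC hiC hjC hij

end Circuits

section TwoSplit

variable {α : Type*} {M : Matroid α} {A B D : Set α} {τ : Set α → Prop} {i j e : α}

/-- The trace on `A` of a base `B`, together with the new element `none` if `B` satisfies `τ`. -/
def halfBase (A : Set α) (τ : Set α → Prop) (B : Set α) : Set (Option α) :=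
  {o | match o with
    | some e => e ∈ B ∧ e ∈ A
    | none => τ B}

@[simp] theorem some_mem_halfBase : some e ∈ halfBase A τ B ↔ e ∈ B ∧ e ∈ A := Iff.rfl

@[simp] theorem none_mem_halfBase : none ∈ halfBase A τ B ↔ τ B := Iff.rfl

theorem mem_image_getD {D : Set (Option α)} :
    e ∈ (·.getD i) '' D ↔ some e ∈ D ∨ e = i ∧ none ∈ D := by
  simp [Option.exists, or_comm, and_comm, eq_comm]

theorem image_getD_halfBase (B : Set α) :
    (fun o : Option α => o.getD i) '' halfBase A τ B = B ∩ A ∪ {e | e = i ∧ τ B} := by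
  ext e
  rw [mem_image_getD]
  rfl

theorem bijOn_getD (hi : i ∉ A) : BijOn (·.getD i) (insert none (some '' A)) (insert i A) := by
  refine ⟨?_, ?_, ?_⟩
  · rintro _ (rfl | ⟨e, he, rfl⟩)
    exacts [mem_insert _ _, Or.inr he]
  · rintro _ (rfl | ⟨e, he, rfl⟩) _ (rfl | ⟨e', he', rfl⟩) hee' <;> simp_all
  · rintro e (rfl | he)
    exacts [⟨none, mem_insert _ _, rfl⟩, ⟨some e, Or.inr ⟨e, he, rfl⟩, rfl⟩]

/-- A 2-separation of `M` on the level of bases: there are two types of bases, told apart by `τ`,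
and the part in `A` of a base can be replaced by the part in `A` of any base of the same type. The
exchange of `i ∉ A` for `j ∈ A` changes the type of `B`. -/
structure IsTwoSplit (M : Matroid α) (A : Set α) (τ : Set α → Prop) (B : Set α) (i j : α) : Prop
    extends IsExchange M B i j where
  subset_ground : A ⊆ M.E
  isBase_mix : ∀ ⦃B B'⦄, M.IsBase B → M.IsBase B' → (τ B ↔ τ B') → M.IsBase (B ∩ A ∪ B' \ A)
  notMem_left : i ∉ A
  mem_right : j ∈ A
  pos : τ B
  neg : ¬ τ (insert j (B \ {i}))

/-- `N` is the summand on the side `A` of the 2-sum decomposition of `M` that is given by a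
2-separation `(A, τ)`; its element `none` is the one shared by the two summands. -/
def IsHalf (N : Matroid (Option α)) (M : Matroid α) (A : Set α) (τ : Set α → Prop) : Prop :=
  N.E = insert none (some '' A) ∧ ∀ D, N.IsBase D ↔ ∃ B, M.IsBase B ∧ halfBase A τ B = D

theorem IsHalf.finite [M.Finite] {N : Matroid (Option α)} (hN : IsHalf N M A τ) (hA : A ⊆ M.E) :
    N.Finite :=
  ⟨hN.1 ▸ ((M.ground_finite.subset hA).image _).insert _⟩

namespace IsTwoSplit

theorem compl (h : IsTwoSplit M A τ B i j) :
    IsTwoSplit M (M.E \ A) (fun B => ¬ τ B) (insert j (B \ {i})) j i where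
  toIsExchange := h.symm
  subset_ground := sdiff_subset
  isBase_mix D D' hD hD' hτ := by
    have := hD.subset_ground
    have := hD'.subset_ground
    have heq : D ∩ (M.E \ A) ∪ D' \ (M.E \ A) = D' ∩ A ∪ D \ A := by grind
    exact heq ▸ h.isBase_mix hD' hD (not_iff_not.1 hτ.symm)
  notMem_left hj := hj.2 h.mem_right
  mem_right := ⟨h.isBase.subset_ground h.mem, h.notMem_left⟩
  pos := h.neg
  neg := by rw [h.insert_sdiff_cancel]; exact not_not_intro h.pos

theorem insert_sdiff (h : IsTwoSplit M A τ B i j) :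
    insert j (B \ {i}) \ A = (B \ {i}) \ A :=
  insert_sdiff_of_mem _ h.mem_right

theorem sdiff_eq_insert (h : IsTwoSplit M A τ B i j) : B \ A = insert i ((B \ {i}) \ A) := by
  rw [← insert_sdiff_of_notMem _ h.notMem_left, insert_sdiff_self_of_mem h.mem]

theorem isBase_inter_union (h : IsTwoSplit M A τ B i j) (hD : M.IsBase D) :
    M.IsBase ((D ∩ A ∪ {e | e = i ∧ τ D}) ∪ (B \ {i}) \ A) := by
  by_cases hτ : τ D
  · have := h.isBase_mix hD h.isBase (iff_of_true hτ h.pos)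
    rw [h.sdiff_eq_insert] at this
    simpa [hτ, union_assoc, insert_union] using this
  · have := h.isBase_mix hD h.isBase_exchange (iff_of_false hτ h.neg)
    rw [h.insert_sdiff] at this
    simpa [hτ] using this

theorem iff_mem (h : IsTwoSplit M A τ B i j) (hD : M.IsBase D)
    (hDB : (D \ {i}) \ A = (B \ {i}) \ A) : τ D ↔ i ∈ D := by
  by_cases hi : i ∈ D
  · refine iff_of_true (by_contra fun hτ => ?_) hi
    have hDA : D \ A = B \ A := by
      rw [h.sdiff_eq_insert, ← hDB, ← insert_sdiff_of_notMem _ h.notMem_left,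
        insert_sdiff_self_of_mem hi]
    have hbase := h.isBase_mix h.isBase_exchange hD (iff_of_false h.neg hτ)
    have hsub : B ⊆ insert j (B \ {i}) ∩ A ∪ D \ A := fun e he => by
      by_cases heA : e ∈ A
      · exact Or.inl ⟨Or.inr ⟨he, fun hei => h.notMem_left (hei ▸ heA)⟩, heA⟩
      · exact Or.inr (hDA ▸ ⟨he, heA⟩)
    have hj : j ∈ insert j (B \ {i}) ∩ A ∪ D \ A := Or.inl ⟨mem_insert _ _, h.mem_right⟩
    exact h.notMem (h.isBase.eq_of_subset_isBase hbase hsub ▸ hj)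
  · refine iff_of_false (fun hτ => ?_) hi
    have hDA : D \ A = (B \ {i}) \ A := by rw [← hDB, sdiff_singleton_eq_self hi]
    have hbase := h.isBase_mix h.isBase hD (iff_of_true h.pos hτ)
    have heq := hbase.eq_of_subset_isBase h.isBase (by rw [hDA]; grind)
    exact (heq.symm.subset h.mem).elim (fun h' => h.notMem_left h'.2) fun h' => hi h'.1

/-- The summand is the minor of `M` obtained by contracting all of `B \ A` but `i` and restricting
to `A` and `i`, where `i` takes the role of `none`. -/
theorem exists_isHalf (h : IsTwoSplit M A τ B i j) :
    ∃ N : Matroid (Option α), IsHalf N M A τ := by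
  set T := (B \ {i}) \ A with hT
  have hTi : M.Indep T := h.isBase.indep.subset (sdiff_subset.trans sdiff_subset)
  have hdisj : Disjoint (insert i A) T := by
    simp [hT, disjoint_sdiff_right]
  have hbase : ∀ D ⊆ insert i A, (M ／ T).IsBase D ↔ M.IsBase (D ∪ T) := fun D hD => by
    rw [hTi.contract_isBase_iff, and_iff_left (hdisj.mono_left hD)]
  have hsub : insert i A ⊆ M.E :=
    insert_subset (h.isBase.subset_ground h.mem) h.subset_ground
  have hspan : (M ／ T).Spanning (insert i A) := by
    have := (hbase _ (by grind)).2 (h.isBase_inter_union h.isBase)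
    exact this.spanning.superset (by grind) (subset_sdiff.2 ⟨hsub, hdisj⟩)
  refine ⟨((M ／ T) ↾ insert i A).comapOn (insert none (some '' A)) (·.getD i), rfl, fun D => ?_⟩
  rw [comapOn_isBase_iff_of_bijOn (bijOn_getD h.notMem_left), hspan.isBase_restrict_iff]
  constructor
  · rintro ⟨⟨hD, hDi⟩, hDE⟩
    rw [hbase _ hDi] at hD
    have hsome : ∀ e, some e ∈ D → e ∈ A := fun e he => by simpa using hDE he
    refine ⟨_, hD, ext fun o => ?_⟩
    cases o with
    | none =>
      rw [none_mem_halfBase, h.iff_mem hD (by grind), mem_union, mem_image_getD]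
      simpa [hT] using fun hi => absurd (hsome i hi) h.notMem_left
    | some e =>
      simp only [some_mem_halfBase, mem_union, mem_image_getD, hT, mem_sdiff]
      grind [h.notMem_left]
  · rintro ⟨D, hD, rfl⟩
    rw [image_getD_halfBase]
    refine ⟨⟨(hbase _ (by grind)).2 (h.isBase_inter_union hD), by grind⟩, ?_⟩
    rintro (_ | e) he
    · exact mem_insert _ _
    · exact Or.inr ⟨e, he.2, rfl⟩

variable {M₁ M₂ : Matroid (Option α)}

theorem not_isLoop_none (h : IsTwoSplit M A τ B i j) (h₁ : IsHalf M₁ M A τ) :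
    ¬ M₁.IsLoop none := by
  rw [isLoop_iff_forall_notMem_isBase (by simp [h₁.1])]
  exact fun hloop => hloop _ ((h₁.2 _).2 ⟨B, h.isBase, rfl⟩) h.pos

theorem not_isColoop_none (h : IsTwoSplit M A τ B i j) (h₁ : IsHalf M₁ M A τ) :
    ¬ M₁.IsColoop none := by
  rw [isColoop_iff_forall_mem_isBase]
  exact fun hcoloop => h.neg (hcoloop ((h₁.2 _).2 ⟨_, h.isBase_exchange, rfl⟩))

theorem isTwoSum (h : IsTwoSplit M A τ B i j) (h₁ : IsHalf M₁ M A τ)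
    (h₂ : IsHalf M₂ M (M.E \ A) fun B => ¬ τ B) :
    IsTwoSum (M.mapEmbedding Function.Embedding.some) M₁ M₂ none := by
  refine ⟨?_, h.not_isLoop_none h₁, h.not_isColoop_none h₁, h.compl.not_isLoop_none h₂,
    h.compl.not_isColoop_none h₂, ?_, fun D => ?_⟩
  · rw [h₁.1, h₂.1]
    ext (_ | e) <;> simp +contextual
  · have := h.subset_ground
    rw [h₁.1, h₂.1]
    ext (_ | e) <;> simp
    grind
  · simp only [mapEmbedding, map_isBase_iff, h₁.2, h₂.2]
    constructor
    · rintro ⟨D, hD, rfl⟩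
      refine ⟨_, _, ⟨D, hD, rfl⟩, ⟨D, hD, rfl⟩, by simp [mem_symmDiff, em], ?_⟩
      have := hD.subset_ground
      ext (_ | e) <;> simp
      grind
    · rintro ⟨_, _, ⟨D₁, hD₁, rfl⟩, ⟨D₂, hD₂, rfl⟩, hp, rfl⟩
      simp only [mem_symmDiff, none_mem_halfBase] at hp
      refine ⟨_, h.isBase_mix hD₁ hD₂ (by tauto), ?_⟩
      have := hD₂.subset_ground
      ext (_ | e) <;> simp
      grind

end IsTwoSplit

theorem IsTwoSum.symm {β : Type*} {N M₁ M₂ : Matroid β} {p : β} (h : IsTwoSum N M₁ M₂ p) :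
    IsTwoSum N M₂ M₁ p := by
  obtain ⟨hE, hl₁, hc₁, hl₂, hc₂, hN, hB⟩ := h
  refine ⟨inter_comm _ _ ▸ hE, hl₂, hc₂, hl₁, hc₁, union_comm _ _ ▸ hN, fun B => (hB B).trans ?_⟩
  constructor <;> rintro ⟨B₁, B₂, h₁, h₂, hp, rfl⟩ <;>
    exact ⟨B₂, B₁, h₂, h₁, symmDiff_comm B₁ B₂ ▸ hp, by rw [union_comm]⟩

end TwoSplit

section CharVec

variable {α : Type*} {M : Matroid α} {X B B' D : Set α}

/-- The characteristic vector of `B` in `ℝ^X`; elements of `B` outside `X` are ignored. -/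
noncomputable def charVec (X B : Set α) : X → ℝ := fun e => B.indicator (fun _ => 1) (e : α)

open scoped Classical in
theorem charVec_apply (e : X) : charVec X B e = if (e : α) ∈ B then 1 else 0 :=
  indicator_apply B _ _

theorem charVec_eq_one_iff {e : X} : charVec X B e = 1 ↔ (e : α) ∈ B := by
  simp [charVec_apply]

theorem charVec_injOn : InjOn (charVec X) (𝒫 X) := fun B hB B' hB' h => by
  ext e
  by_cases he : e ∈ X
  · rw [← charVec_eq_one_iff (e := ⟨e, he⟩), h, charVec_eq_one_iff]
  · exact iff_of_false (fun h' => he (hB h')) fun h' => he (hB' h')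

theorem charVec_mem_extremePoints_cube :
    charVec X B ∈ (univ.pi fun _ : X => Icc (0 : ℝ) 1).extremePoints ℝ := by
  rw [extremePoints_pi]
  intro e _
  rw [extremePoints_Icc zero_le_one, charVec_apply]
  split_ifs <;> simp

theorem sum_charVec [Fintype X] (hD : D ⊆ X) : ∑ e, charVec X D e = D.ncard := by
  classical
  have hcard : ({e : X | (e : α) ∈ D} : Set X).ncard = D.ncard := by
    rw [← ncard_image_of_injective _ Subtype.val_injective]
    congr 1
    ext e
    simpa using fun he => hD he
  simp only [charVec_apply, Finset.sum_boole, ← hcard]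
  rw [← ncard_coe_finset, Finset.coe_filter_univ]

theorem charVec_inter_add_charVec_inter_sdiff (X A D : Set α) :
    charVec X (D ∩ A) + charVec X (D ∩ (X \ A)) = charVec X D := by
  classical
  ext e
  simp only [Pi.add_apply, charVec_apply, mem_inter_iff, mem_sdiff]
  split_ifs <;> simp_all

theorem IsExchange.charVec_sub [DecidableEq M.E] {i j : M.E} (h : IsExchange M B i j) :
    charVec M.E (insert (j : α) (B \ {(i : α)})) - charVec M.E B =
      Pi.single j 1 - Pi.single i 1 := by
  classical
  have hi := h.mem
  have hj := h.notMem
  have hij := h.ne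
  ext e
  simp only [Pi.sub_apply, charVec_apply, Pi.single_apply, mem_insert_iff, mem_sdiff,
    mem_singleton_iff, Subtype.ext_iff]
  grind

theorem basePolytope_eq_convexHull (M : Matroid α) :
    basePolytope M = convexHull ℝ (charVec M.E '' {B | M.IsBase B}) := by
  simp only [basePolytope, image, mem_ofPred_eq, eq_comm]
  rfl

theorem charVec_mem_basePolytope (hB : M.IsBase B) : charVec M.E B ∈ basePolytope M :=
  subset_convexHull ℝ _ ⟨B, hB, rfl⟩

theorem basePolytope_subset_cube : basePolytope M ⊆ univ.pi fun _ : M.E => Icc (0 : ℝ) 1 := by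
  refine convexHull_min ?_ (convex_pi fun _ _ => convex_Icc 0 1)
  rintro _ ⟨B, -, rfl⟩
  exact (charVec_mem_extremePoints_cube (B := B)).1

theorem extremePoints_basePolytope :
    (basePolytope M).extremePoints ℝ = charVec M.E '' {B | M.IsBase B} := by
  refine Subset.antisymm ?_ ?_
  · rw [basePolytope_eq_convexHull]
    exact extremePoints_convexHull_subset
  · rintro _ ⟨B, hB, rfl⟩
    exact inter_extremePoints_subset_extremePoints_of_subset basePolytope_subset_cube
      ⟨charVec_mem_basePolytope hB, charVec_mem_extremePoints_cube⟩

end CharVec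

section SlackMatrix

variable {ι κ V : Type*} [AddCommGroup V] [Module ℝ V]

theorem exists_coe_affineSubspace_eq [FiniteDimensional ℝ V] (s : AffineSubspace ℝ V) :
    ∃ (k : ℕ) (C : Fin k → V →ₗ[ℝ] ℝ) (d : Fin k → ℝ), (s : Set V) = {u | ∀ l, C l u = d l} := by
  obtain rfl | ⟨p, hp⟩ := s.eq_bot_or_nonempty
  · exact ⟨1, 0, 1, by ext; simp⟩
  let b := Module.finBasis ℝ (V ⧸ s.direction)
  refine ⟨_, fun l => b.coord l ∘ₗ s.direction.mkQ, fun l => b.coord l (s.direction.mkQ p), ?_⟩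
  ext u
  calc u ∈ s ↔ s.direction.mkQ u = s.direction.mkQ p := by
        rw [← AffineSubspace.vsub_right_mem_direction_iff_mem hp, vsub_eq_sub, ← sub_eq_zero,
          ← map_sub, Submodule.mkQ_apply, Submodule.Quotient.mk_eq_zero]
    _ ↔ _ := b.ext_elem_iff

theorem isSlackMatrix_iff [FiniteDimensional ℝ V] {S : Matrix ι κ ℝ} {P : Set V} :
    IsSlackMatrix S P ↔ ∃ (f : ι → V →ᵃ[ℝ] ℝ) (v : κ → V), Function.Injective v ∧
      range v = P.extremePoints ℝ ∧ P = convexHull ℝ (range v) ∧ (∀ i j, S i j = f i (v j)) ∧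
      (∀ i j, 0 ≤ S i j) ∧ ∀ u ∈ affineSpan ℝ P, (∀ i, 0 ≤ f i u) → u ∈ P := by
  constructor
  · rintro ⟨A, b, k, C, d, v, hv, hext, hhull, hP, hS⟩
    have hvP : ∀ j, v j ∈ P := fun j => extremePoints_subset (hext.subset ⟨j, rfl⟩)
    refine ⟨fun i => AffineMap.const ℝ V (b i) - (A i).toAffineMap, v, hv, hext, hhull, hS,
      fun i j => ?_, fun u hu hfu => ?_⟩
    · rw [hS, sub_nonneg]
      exact (hP.subset (hvP j)).1 i
    · rw [hP]
      refine ⟨fun i => sub_nonneg.1 (hfu i), fun l => ?_⟩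
      exact AffineMap.eqOn_affineSpan (f := (C l).toAffineMap) (g := AffineMap.const ℝ V (d l))
        (fun w hw => (hP.subset hw).2 l) hu
  · rintro ⟨f, v, hv, hext, hhull, hS, hnonneg, hmem⟩
    obtain ⟨k, C, d, hspan⟩ := exists_coe_affineSubspace_eq (affineSpan ℝ P)
    have hf : ∀ i u, f i 0 - (-(f i).linear) u = f i u := fun i u => by
      rw [LinearMap.neg_apply, sub_neg_eq_add, add_comm, (f i).decomp']
      simp
    refine ⟨fun i => -(f i).linear, fun i => f i 0, k, C, d, v, hv, hext, hhull, ?_, ?_⟩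
    · ext u
      simp only [mem_ofPred_eq, ← sub_nonneg (b := (-(f _).linear) u), hf]
      refine ⟨fun hu => ⟨fun i => ?_, hspan.subset (subset_affineSpan ℝ P hu)⟩,
        fun ⟨h₁, h₂⟩ => hmem u (hspan.superset h₂) h₁⟩
      have hconv : Convex ℝ (f i ⁻¹' Ici 0) := (convex_Ici 0).affine_preimage (f i)
      refine convexHull_min ?_ hconv (hhull.subset hu)
      rintro _ ⟨j, rfl⟩
      exact (hnonneg i j).trans_eq (hS i j)
    · intro i j
      rw [hf, hS]

variable {α : Type*} {N : Matroid α} {S : Matrix ι κ ℝ} {x : ι}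

theorem isSlackMatrix_basePolytope [N.Finite] {w : κ → Set α} (hinj : Function.Injective w)
    (hw : range w = {D | N.IsBase D}) (f : ι → (N.E → ℝ) →ᵃ[ℝ] ℝ)
    (hf : ∀ i j, S i j = f i (charVec N.E (w j))) (hS : ∀ i j, 0 ≤ S i j)
    (hmem : ∀ u ∈ affineSpan ℝ (basePolytope N), (∀ i, 0 ≤ f i u) → u ∈ basePolytope N) :
    IsSlackMatrix S (basePolytope N) := by
  have : Finite N.E := N.ground_finite
  have hrange : range (fun j => charVec N.E (w j)) = charVec N.E '' {D | N.IsBase D} := by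
    rw [← hw, ← range_comp, Function.comp_def]
  refine isSlackMatrix_iff.2 ⟨f, fun j => charVec N.E (w j), fun j j' h => hinj ?_, ?_, ?_, hf, hS,
    hmem⟩
  · have hsub : ∀ j, w j ⊆ N.E := fun j => (hw.subset ⟨j, rfl⟩ : N.IsBase (w j)).subset_ground
    exact charVec_injOn (hsub j) (hsub j') h
  · rw [hrange, extremePoints_basePolytope]
  · rw [hrange, basePolytope_eq_convexHull]

theorem addComplRow_nonneg (hS : ∀ i j, 0 ≤ S i j) (hx : IsSpecialRow S x) (i : ι ⊕ Unit) (j : κ) :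
    0 ≤ addComplRow S x i j := by
  rcases i with i | -
  · exact hS i j
  · change 0 ≤ 1 - S x j
    rcases hx.1 j with h | h <;> simp [h]

theorem exists_affineMap_charVec {X D₀ D₁ : Set α} (hX : D₁ ⊆ X) (h : ¬ D₁ ⊆ D₀) :
    ∃ η : (X → ℝ) →ᵃ[ℝ] ℝ, η (charVec X D₀) = 0 ∧ η (charVec X D₁) = 1 := by
  obtain ⟨e, he₁, he₀⟩ := not_subset.1 h
  refine ⟨(LinearMap.proj ⟨e, hX he₁⟩).toAffineMap, ?_, ?_⟩
  · simp [charVec_apply, he₀]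
  · simp [charVec_apply, he₁]

theorem isSlackMatrix_addComplRow_of_injective [N.Finite] (hS : ∀ i j, 0 ≤ S i j)
    (hx : IsSpecialRow S x) (hinj : Function.Injective (S x)) {D₀ D₁ : Set α} (hne : D₀ ≠ D₁)
    (hN : ∀ D, N.IsBase D ↔ D = D₀ ∨ D = D₁) :
    IsSlackMatrix (addComplRow S x) (basePolytope N) := by
  classical
  have hD₀ : N.IsBase D₀ := (hN D₀).2 (Or.inl rfl)
  have hD₁ : N.IsBase D₁ := (hN D₁).2 (Or.inr rfl)
  obtain ⟨c₀, hc₀⟩ := hx.2.1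
  obtain ⟨c₁, hc₁⟩ := hx.2.2
  obtain ⟨η, hη₀, hη₁⟩ := exists_affineMap_charVec hD₁.subset_ground
    fun h => hne (hD₁.eq_of_subset_isBase hD₀ h).symm
  let f (i : ι ⊕ Unit) : (N.E → ℝ) →ᵃ[ℝ] ℝ :=
    (AffineMap.lineMap (addComplRow S x i c₀) (addComplRow S x i c₁)).comp η
  let w (j : κ) : Set α := if S x j = 0 then D₀ else D₁
  have hw₀ : w c₀ = D₀ := if_pos hc₀
  have hw₁ : w c₁ = D₁ := if_neg (by simp [hc₁])
  have hcol : ∀ j, j = c₀ ∨ j = c₁ := fun j =>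
    (hx.1 j).imp (fun h => hinj (h.trans hc₀.symm)) fun h => hinj (h.trans hc₁.symm)
  refine isSlackMatrix_basePolytope (w := w) ?_ ?_ f ?_ (addComplRow_nonneg hS hx) ?_
  · intro j j' h
    rcases hcol j with rfl | rfl <;> rcases hcol j' with rfl | rfl <;> simp_all
  · ext D
    rw [mem_ofPred_eq, hN, ← hw₀, ← hw₁]
    refine ⟨?_, by rintro (rfl | rfl) <;> exact mem_range_self _⟩
    rintro ⟨j, rfl⟩
    exact (hcol j).imp (congrArg w) (congrArg w)
  · intro i j
    rcases hcol j with rfl | rfl <;> simp [f, hw₀, hw₁, hη₀, hη₁]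
  · intro u hu hfu
    have hpair : u ∈ line[ℝ, charVec N.E D₀, charVec N.E D₁] := by
      rw [basePolytope_eq_convexHull, affineSpan_convexHull] at hu
      have : {D | N.IsBase D} = {D₀, D₁} := ext hN
      rwa [this, image_pair] at hu
    obtain ⟨t, rfl⟩ := mem_affineSpan_pair_iff_exists_lineMap_eq.1 hpair
    have hf : ∀ i, f i (AffineMap.lineMap (charVec N.E D₀) (charVec N.E D₁) t) =
        (1 - t) * addComplRow S x i c₀ + t * addComplRow S x i c₁ := fun i => by
      rw [AffineMap.comp_apply, AffineMap.apply_lineMap η, hη₀, hη₁, AffineMap.lineMap_apply_ring,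
        AffineMap.lineMap_apply_ring]
      ring
    have ht : 0 ≤ t := by
      simpa [hf, addComplRow, hc₀, hc₁] using hfu (Sum.inl x)
    have ht' : t ≤ 1 := by
      simpa [hf, addComplRow, hc₀, hc₁] using hfu (Sum.inr ())
    exact (convex_convexHull ℝ _).lineMap_mem (charVec_mem_basePolytope hD₀)
      (charVec_mem_basePolytope hD₁) ⟨ht, ht'⟩

end SlackMatrix

section Factorization

variable {α ι κ ι' κ' ι₁ κ₁ ι₂ κ₂ V : Type*} [AddCommGroup V] [Module ℝ V]
  {S₁ : Matrix ι₁ κ₁ ℝ} {x : ι₁} {S₂ : Matrix ι₂ κ₂ ℝ} {y : ι₂}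

theorem IsSlackMatrix.of_matrixIso [FiniteDimensional ℝ V] {S : Matrix ι κ ℝ} {T : Matrix ι' κ' ℝ}
    {P : Set V} (hS : IsSlackMatrix S P) (h : MatrixIso S T) : IsSlackMatrix T P := by
  obtain ⟨e, g, rfl⟩ := h
  obtain ⟨f, v, hv, hext, hP, hSf, hnonneg, hmem⟩ := isSlackMatrix_iff.1 hS
  have hrange : range (v ∘ g.symm) = range v := g.symm.surjective.range_comp v
  refine isSlackMatrix_iff.2 ⟨f ∘ e.symm, v ∘ g.symm, hv.comp g.symm.injective, hrange ▸ hext,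
    hrange ▸ hP, fun i j => ?_, fun i j => ?_, fun u hu h => hmem u hu fun i => ?_⟩
  · simpa using hSf (e.symm i) (g.symm j)
  · simpa using hnonneg (e.symm i) (g.symm j)
  · simpa using h (e i)

open scoped Classical in
/-- The row of `(S₁, x) ⊗₂ (S₂, y)` that is inherited from the row `i` of `S₁`. -/
noncomputable def leftRow (x : ι₁) (y : ι₂) (i : ι₁) :
    ({i : ι₁ // i ≠ x} ⊕ {i : ι₂ // i ≠ y}) ⊕ Unit :=
  if h : i = x then Sum.inr () else Sum.inl (Sum.inl ⟨i, h⟩)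

open scoped Classical in
/-- The row of `(S₁, x) ⊗₂ (S₂, y)` that is inherited from the row `i` of `S₂`. -/
noncomputable def rightRow (x : ι₁) (y : ι₂) (i : ι₂) :
    ({i : ι₁ // i ≠ x} ⊕ {i : ι₂ // i ≠ y}) ⊕ Unit :=
  if h : i = y then Sum.inr () else Sum.inl (Sum.inr ⟨i, h⟩)

theorem twoProduct_leftRow (i : ι₁) (c : {c : κ₁ × κ₂ // S₁ x c.1 = S₂ y c.2}) :
    twoProduct S₁ x S₂ y (leftRow x y i) c = S₁ i c.1.1 := by
  unfold leftRow
  split_ifs with h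
  · rw [h]; rfl
  · rfl

theorem twoProduct_rightRow (i : ι₂) (c : {c : κ₁ × κ₂ // S₁ x c.1 = S₂ y c.2}) :
    twoProduct S₁ x S₂ y (rightRow x y i) c = S₂ i c.1.2 := by
  unfold rightRow
  split_ifs with h
  · rw [h, ← c.2]; rfl
  · rfl

theorem forall_leftRow_rightRow {p : ({i : ι₁ // i ≠ x} ⊕ {i : ι₂ // i ≠ y}) ⊕ Unit → Prop}
    (h₁ : ∀ i, p (leftRow x y i)) (h₂ : ∀ i, p (rightRow x y i)) : ∀ i, p i := by
  rintro ((i | i) | -)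
  · simpa [leftRow, i.2] using h₁ i
  · simpa [rightRow, i.2] using h₂ i
  · simpa [leftRow] using h₁ x

/-- The bases of `M`, which index the vertices of its base polytope. -/
abbrev Base (M : Matroid α) : Type _ := {B : Set α // M.IsBase B}

/-- A description of the base polytope of `M` whose slack matrix is `(S₁, x) ⊗₂ (S₂, y)`: the
inequalities are `0 ≤ row₁ i` and `0 ≤ row₂ i`, and the column that belongs to the base `B` is
composed of the columns `col₁ B` and `col₂ B`. -/
structure Factorization (M : Matroid α) (S₁ : Matrix ι₁ κ₁ ℝ) (x : ι₁) (S₂ : Matrix ι₂ κ₂ ℝ)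
    (y : ι₂) where
  row₁ : ι₁ → (M.E → ℝ) →ᵃ[ℝ] ℝ
  row₂ : ι₂ → (M.E → ℝ) →ᵃ[ℝ] ℝ
  col₁ : Base M → κ₁
  col₂ : Base M → κ₂
  isSpecialRow₁ : IsSpecialRow S₁ x
  isSpecialRow₂ : IsSpecialRow S₂ y
  special_eq : ∀ B, S₁ x (col₁ B) = S₂ y (col₂ B)
  exists_base : ∀ {c d}, S₁ x c = S₂ y d → ∃ B, col₁ B = c ∧ col₂ B = d
  eq_of_col_eq : ∀ {B B'}, col₁ B = col₁ B' → col₂ B = col₂ B' → B = B'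
  row₁_charVec : ∀ i B, row₁ i (charVec M.E B.1) = S₁ i (col₁ B)
  row₂_charVec : ∀ i B, row₂ i (charVec M.E B.1) = S₂ i (col₂ B)
  nonneg₁ : ∀ i B, 0 ≤ S₁ i (col₁ B)
  nonneg₂ : ∀ i B, 0 ≤ S₂ i (col₂ B)
  mem_basePolytope : ∀ u ∈ affineSpan ℝ (basePolytope M), (∀ i, 0 ≤ row₁ i u) →
    (∀ i, 0 ≤ row₂ i u) → u ∈ basePolytope M

variable {M : Matroid α}

theorem exists_equiv_base {v : κ → M.E → ℝ} (hv : Function.Injective v)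
    (hext : range v = (basePolytope M).extremePoints ℝ) :
    ∃ g : Base M ≃ κ, ∀ B, v (g B) = charVec M.E B.1 := by
  have hbase : range v = range fun B : Base M => charVec M.E B.1 := by
    rw [hext, extremePoints_basePolytope, image_eq_range]
    rfl
  have hinj : Function.Injective fun B : Base M => charVec M.E B.1 := fun B B' h =>
    Subtype.ext (charVec_injOn B.2.subset_ground B'.2.subset_ground h)
  refine ⟨(Equiv.ofInjective _ hinj).trans
    ((Equiv.setCongr hbase.symm).trans (Equiv.ofInjective v hv).symm), fun B => ?_⟩
  exact Equiv.apply_ofInjective_symm hv _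

theorem IsSlackMatrix.nonempty_factorization [M.Finite] {S : Matrix ι κ ℝ}
    (hS : IsSlackMatrix S (basePolytope M)) (hprod : IsTwoProduct S S₁ x S₂ y) :
    Nonempty (Factorization M S₁ x S₂ y) := by
  have : Finite M.E := M.ground_finite
  obtain ⟨hx, hy, hiso⟩ := hprod
  obtain ⟨f, v, hv, hext, -, hf, hnonneg, hmem⟩ := isSlackMatrix_iff.1 (hS.of_matrixIso hiso)
  obtain ⟨g, hg⟩ := exists_equiv_base hv hext
  exact ⟨{
    row₁ i := f (leftRow x y i)
    row₂ i := f (rightRow x y i)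
    col₁ B := (g B).1.1
    col₂ B := (g B).1.2
    isSpecialRow₁ := hx
    isSpecialRow₂ := hy
    special_eq B := (g B).2
    exists_base {c d} h := ⟨g.symm ⟨(c, d), h⟩, by simp, by simp⟩
    eq_of_col_eq h₁ h₂ := g.injective (Subtype.ext (Prod.ext h₁ h₂))
    row₁_charVec i B := by rw [← hg, ← hf, twoProduct_leftRow]
    row₂_charVec i B := by rw [← hg, ← hf, twoProduct_rightRow]
    nonneg₁ i B := twoProduct_leftRow i (g B) ▸ hnonneg _ _
    nonneg₂ i B := twoProduct_rightRow i (g B) ▸ hnonneg _ _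
    mem_basePolytope u hu h₁ h₂ := hmem u hu (forall_leftRow_rightRow h₁ h₂) }⟩

namespace Factorization

variable (F : Factorization M S₁ x S₂ y)

/-- The same description with the two factors interchanged. -/
def swap : Factorization M S₂ y S₁ x where
  row₁ := F.row₂
  row₂ := F.row₁
  col₁ := F.col₂
  col₂ := F.col₁
  isSpecialRow₁ := F.isSpecialRow₂
  isSpecialRow₂ := F.isSpecialRow₁
  special_eq B := (F.special_eq B).symm
  exists_base h := let ⟨B, h₁, h₂⟩ := F.exists_base h.symm; ⟨B, h₂, h₁⟩
  eq_of_col_eq h₁ h₂ := F.eq_of_col_eq h₂ h₁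
  row₁_charVec := F.row₂_charVec
  row₂_charVec := F.row₁_charVec
  nonneg₁ := F.nonneg₂
  nonneg₂ := F.nonneg₁
  mem_basePolytope u hu h₁ h₂ := F.mem_basePolytope u hu h₂ h₁

/-- The directions in the affine hull of the base polytope along which only the rows of the first
factor change. -/
def dir₁ : Submodule ℝ (M.E → ℝ) :=
  vectorSpan ℝ (basePolytope M) ⊓ ⨅ i, LinearMap.ker (F.row₂ i).linear

/-- The directions in the affine hull of the base polytope along which only the rows of the second
factor change. -/
def dir₂ : Submodule ℝ (M.E → ℝ) := F.swap.dir₁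

theorem mem_dir₁ {u : M.E → ℝ} :
    u ∈ F.dir₁ ↔ u ∈ vectorSpan ℝ (basePolytope M) ∧ ∀ i, (F.row₂ i).linear u = 0 := by
  simp [dir₁]

theorem charVec_sub_mem_dir₁ {B B' : Base M} (h : F.col₂ B = F.col₂ B') :
    charVec M.E B.1 - charVec M.E B'.1 ∈ F.dir₁ := by
  refine F.mem_dir₁.2 ⟨vsub_mem_vectorSpan ℝ (charVec_mem_basePolytope B.2)
    (charVec_mem_basePolytope B'.2), fun i => ?_⟩
  rw [← vsub_eq_sub, AffineMap.linearMap_vsub, F.row₂_charVec, F.row₂_charVec, h, vsub_self]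

theorem charVec_sub_mem_dir₂ {B B' : Base M} (h : F.col₁ B = F.col₁ B') :
    charVec M.E B.1 - charVec M.E B'.1 ∈ F.dir₂ :=
  F.swap.charVec_sub_mem_dir₁ h

/-- A common direction is the direction of a line in the base polytope, which is bounded. -/
theorem disjoint_dir : Disjoint F.dir₁ F.dir₂ := by
  refine Submodule.disjoint_def.2 fun u hu₁ hu₂ => ?_
  obtain ⟨hspan, h₂⟩ := F.mem_dir₁.1 hu₁
  have h₁ := (F.swap.mem_dir₁.1 hu₂).2
  obtain ⟨B, hB⟩ := M.exists_isBase
  set p := charVec M.E B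
  have hp := charVec_mem_basePolytope hB
  have hline : ∀ t : ℝ, t • u +ᵥ p ∈ basePolytope M := fun t => by
    refine F.mem_basePolytope _ ?_ (fun i => ?_) fun i => ?_
    · refine AffineSubspace.vadd_mem_of_mem_direction ?_ (subset_affineSpan ℝ _ hp)
      rw [direction_affineSpan]
      exact Submodule.smul_mem _ t hspan
    · rw [AffineMap.map_vadd, map_smul, show (F.row₁ i).linear u = 0 from h₁ i, smul_zero,
        zero_vadd, F.row₁_charVec i ⟨B, hB⟩]
      exact F.nonneg₁ i ⟨B, hB⟩
    · rw [AffineMap.map_vadd, map_smul, h₂, smul_zero, zero_vadd, F.row₂_charVec i ⟨B, hB⟩]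
      exact F.nonneg₂ i ⟨B, hB⟩
  ext e
  by_contra hue
  have hcube : ∀ t : ℝ, t * u e + p e ∈ Icc (0 : ℝ) 1 := fun t =>
    basePolytope_subset_cube (hline t) e (mem_univ _)
  have h₀ := hcube 0
  have h₂ := hcube (2 / u e)
  rw [div_mul_cancel₀ _ hue] at h₂
  linarith [h₀.1, h₂.2]

variable {F}

/-- The difference of the two sides lies in both `dir₁` and `dir₂`. -/
theorem charVec_add_charVec_eq {B B' C D : Base M} (hC₁ : F.col₁ C = F.col₁ B)
    (hC₂ : F.col₂ C = F.col₂ B') (hD₁ : F.col₁ D = F.col₁ B') (hD₂ : F.col₂ D = F.col₂ B) :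
    charVec M.E B.1 + charVec M.E B'.1 = charVec M.E C.1 + charVec M.E D.1 := by
  have h₁ := add_mem (F.charVec_sub_mem_dir₁ hD₂.symm) (F.charVec_sub_mem_dir₁ hC₂.symm)
  have h₂ := add_mem (F.charVec_sub_mem_dir₂ hC₁.symm) (F.charVec_sub_mem_dir₂ hD₁.symm)
  rw [← add_sub_add_comm] at h₁ h₂
  rw [add_comm (charVec M.E D.1)] at h₁
  exact sub_eq_zero.1 (Submodule.disjoint_def.1 F.disjoint_dir _ h₁ h₂)

theorem col_eq_or_col_eq_of_eq_insert_sdiff {B B' : Base M} {i j : α}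
    (hB' : B'.1 = insert j (B.1 \ {i})) (hspecial : S₁ x (F.col₁ B) = S₁ x (F.col₁ B')) :
    F.col₁ B = F.col₁ B' ∨ F.col₂ B = F.col₂ B' := by
  obtain ⟨C, hC₁, hC₂⟩ := F.exists_base (hspecial.trans (F.special_eq B'))
  obtain ⟨D, hD₁, hD₂⟩ := F.exists_base (hspecial.symm.trans (F.special_eq B))
  have hsum := charVec_add_charVec_eq hC₁ hC₂ hD₁ hD₂
  have hinter : ∀ e, e ∈ B.1 → e ∈ B'.1 → e ∈ C.1 := fun e he he' => by
    have := congrFun hsum ⟨e, B.2.subset_ground he⟩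
    simp only [Pi.add_apply, charVec_apply, he, he', if_true] at this
    by_contra heC
    rw [if_neg heC] at this
    split_ifs at this <;> norm_num at this
  have hunion : ∀ e ∈ C.1, e ∈ B.1 ∨ e ∈ B'.1 := fun e heC => by
    have := congrFun hsum ⟨e, C.2.subset_ground heC⟩
    simp only [Pi.add_apply, charVec_apply, heC, if_true] at this
    by_contra! he
    rw [if_neg he.1, if_neg he.2] at this
    split_ifs at this <;> norm_num at this
  by_cases hiC : i ∈ C.1
  · have hBC : B.1 ⊆ C.1 := fun e he => by
      by_cases hei : e = i
      · exact hei ▸ hiC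
      · exact hinter e he (hB' ▸ Or.inr ⟨he, hei⟩)
    have heq : B = C := Subtype.ext (B.2.eq_of_subset_isBase C.2 hBC)
    exact Or.inr (heq ▸ hC₂)
  · have hCB' : C.1 ⊆ B'.1 := fun e he =>
      (hunion e he).elim (fun h' => hB' ▸ Or.inr ⟨h', fun hei => hiC (hei ▸ he)⟩) id
    have heq : C = B' := Subtype.ext (C.2.eq_of_subset_isBase B'.2 hCB')
    exact Or.inl (heq ▸ hC₁).symm

end Factorization

end Factorization

section ExchangeSpan

variable {α : Type*} {X A D D' : Set α}

open scoped Classical in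
/-- The span in `ℝ^X` of the differences `e_i - e_j` with `i, j ∈ A`: the vectors that are supported
on `A` and have coordinate sum zero. -/
noncomputable def exchangeSpan (X A : Set α) : Submodule ℝ (X → ℝ) :=
  Submodule.span ℝ {u | ∃ i j : X, (i : α) ∈ A ∧ (j : α) ∈ A ∧ Pi.single i 1 - Pi.single j 1 = u}

theorem mem_exchangeSpan [Fintype X] {u : X → ℝ} (hu : ∀ e : X, (e : α) ∉ A → u e = 0)
    (hsum : ∑ e, u e = 0) : u ∈ exchangeSpan X A := by
  classical
  by_cases hA : ∃ e : X, (e : α) ∈ A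
  · obtain ⟨e₀, he₀⟩ := hA
    have hdecomp : u = ∑ e, u e • (Pi.single e (1 : ℝ) - Pi.single e₀ 1 : X → ℝ) := by
      simp only [smul_sub, Finset.sum_sub_distrib, ← Finset.sum_smul, hsum, zero_smul, sub_zero]
      ext e
      simp [Finset.sum_apply, Pi.single_apply]
    rw [hdecomp]
    refine Submodule.sum_mem _ fun e _ => ?_
    by_cases he : (e : α) ∈ A
    · refine Submodule.smul_mem _ _ (Submodule.subset_span ⟨e, e₀, he, he₀, ?_⟩)
      congr!
    · simp [hu e he]
  · have hzero : u = 0 := funext fun e => hu e fun he => hA ⟨e, he⟩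
    exact hzero ▸ zero_mem _

theorem charVec_inter_sub_mem_exchangeSpan [Finite X] (hD : D ⊆ X) (hD' : D' ⊆ X)
    (hcard : (D ∩ A).ncard = (D' ∩ A).ncard) :
    charVec X (D ∩ A) - charVec X (D' ∩ A) ∈ exchangeSpan X A := by
  have := Fintype.ofFinite X
  refine mem_exchangeSpan (fun e he => by simp [charVec_apply, he]) ?_
  simp only [Pi.sub_apply, Finset.sum_sub_distrib]
  rw [sum_charVec (inter_subset_left.trans hD), sum_charVec (inter_subset_left.trans hD'), hcard,
    sub_self]

theorem eq_top_or_eq_top_of_forall_rel {E : Type*} {r s : Setoid E}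
    (h : ∀ a b, r a b ∨ s a b) : r = ⊤ ∨ s = ⊤ := by
  simp only [Setoid.eq_top_iff]
  refine or_iff_not_imp_left.2 fun hr => ?_
  obtain ⟨a, b, hab⟩ : ∃ a b, ¬ r a b := by simpa using hr
  have hsab : s a b := (h a b).resolve_left hab
  have hs : ∀ c, s c a := fun c => (h c a).elim (fun hca =>
    s.trans ((h c b).resolve_left fun hcb => hab (r.trans (r.symm hca) hcb)) (s.symm hsab)) id
  exact fun c d => s.trans (hs c) (s.symm (hs d))

open scoped Classical in
theorem exchangeSpan_le_or_le {K L : Submodule ℝ (X → ℝ)}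
    (h : ∀ i j : X, (i : α) ∈ A → (j : α) ∈ A → i ≠ j →
      (Pi.single i 1 - Pi.single j 1 : X → ℝ) ∈ K ∨ (Pi.single i 1 - Pi.single j 1 : X → ℝ) ∈ L) :
    exchangeSpan X A ≤ K ∨ exchangeSpan X A ≤ L := by
  let unit (i : {i : X // (i : α) ∈ A}) : X → ℝ := Pi.single i.1 1
  have hle : ∀ K : Submodule ℝ (X → ℝ), K.quotientRel.comap unit = ⊤ → exchangeSpan X A ≤ K := by
    intro K hK
    refine Submodule.span_le.2 ?_
    rintro _ ⟨i, j, hi, hj, rfl⟩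
    have hij := Setoid.eq_top_iff.1 hK ⟨i, hi⟩ ⟨j, hj⟩
    rwa [Setoid.comap_rel, Submodule.quotientRel_def] at hij
  refine (eq_top_or_eq_top_of_forall_rel fun i j => ?_).imp (hle K) (hle L)
  simp only [Setoid.comap_rel, Submodule.quotientRel_def]
  obtain rfl | hij := eq_or_ne i j
  · simp
  · exact h i j i.2 j.2 fun h' => hij (Subtype.ext h')

end ExchangeSpan

section Special

variable {α : Type*} {M : Matroid α} {A : Set α}

theorem IsConnected.exists_linear_single_eq [M.Finite] [DecidableEq M.E] (hM : IsConnected M)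
    {ξ : (M.E → ℝ) →ᵃ[ℝ] ℝ}
    (hξ : ∀ B, M.IsBase B → ξ (charVec M.E B) = 0 ∨ ξ (charVec M.E B) = 1) :
    ∃ A ⊆ M.E, ∃ m, ∀ e : M.E, ξ.linear (Pi.single e 1) = m - charVec M.E A e := by
  obtain hE | hE := isEmpty_or_nonempty M.E
  · exact ⟨∅, empty_subset _, 0, isEmptyElim⟩
  have : Finite M.E := M.ground_finite
  obtain ⟨i, hi⟩ := Finite.exists_max fun e : M.E => ξ.linear (Pi.single e 1)
  refine ⟨Subtype.val '' {e : M.E | ξ.linear (Pi.single e 1) ≠ ξ.linear (Pi.single i 1)},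
    by simp, ξ.linear (Pi.single i 1), fun j => ?_⟩
  by_cases hj : ξ.linear (Pi.single j 1) = ξ.linear (Pi.single i 1)
  · simp [charVec_apply, hj]
  · have hij : (i : α) ≠ j := fun h => hj (Subtype.ext h ▸ rfl)
    obtain ⟨B, hB⟩ := hM.exists_isExchange i.2 j.2 hij
    have hsub : ξ.linear (Pi.single j 1) - ξ.linear (Pi.single i 1) =
        ξ (charVec M.E (insert (j : α) (B \ {(i : α)}))) - ξ (charVec M.E B) := by
      rw [← map_sub, ← hB.charVec_sub, ← vsub_eq_sub, AffineMap.linearMap_vsub, vsub_eq_sub]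
    have hlt := (hi j).lt_of_ne hj
    have hone : charVec M.E (Subtype.val '' {e : M.E | ξ.linear (Pi.single e 1) ≠
        ξ.linear (Pi.single i 1)}) j = 1 := charVec_eq_one_iff.2 ⟨j, hj, rfl⟩
    rw [hone]
    rcases hξ _ hB.isBase with h | h <;> rcases hξ _ hB.isBase_exchange with h' | h' <;>
      rw [h, h'] at hsub <;> linarith

theorem IsConnected.exists_eq_sub_ncard_inter [M.Finite] (hM : IsConnected M)
    {ξ : (M.E → ℝ) →ᵃ[ℝ] ℝ}
    (hξ : ∀ B, M.IsBase B → ξ (charVec M.E B) = 0 ∨ ξ (charVec M.E B) = 1) :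
    ∃ A ⊆ M.E, ∃ k : ℝ, ∀ B, M.IsBase B → ξ (charVec M.E B) = k - (B ∩ A).ncard := by
  classical
  have : Finite M.E := M.ground_finite
  have := Fintype.ofFinite M.E
  obtain ⟨A, hA, m, hm⟩ := hM.exists_linear_single_eq hξ
  obtain ⟨B₀, hB₀⟩ := M.exists_isBase
  refine ⟨A, hA, ξ 0 + m * B₀.ncard, fun B hB => ?_⟩
  have hmul : ∀ e : M.E, charVec M.E B e * charVec M.E A e = charVec M.E (B ∩ A) e := fun e => by
    simp only [charVec_apply, mem_inter_iff, ite_and]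
    split_ifs <;> simp
  calc ξ (charVec M.E B) = ξ 0 + ξ.linear (charVec M.E B) := by
        rw [ξ.decomp', add_comm]
        simp
    _ = ξ 0 + ∑ e, (charVec M.E B e * m - charVec M.E (B ∩ A) e) := by
        conv_lhs => rw [pi_eq_sum_univ' (charVec M.E B)]
        simp only [map_sum, map_smul, smul_eq_mul, hm, mul_sub, hmul]
    _ = ξ 0 + m * B₀.ncard - (B ∩ A).ncard := by
        rw [Finset.sum_sub_distrib, ← Finset.sum_mul, sum_charVec hB.subset_ground,
          sum_charVec (inter_subset_left.trans hB.subset_ground),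
          hB.ncard_eq_ncard_of_isBase hB₀]
        ring

end Special

section SlackMatrixOfHalf

variable {α β : Type*} {M : Matroid α} {N : Matroid β}

theorem eqOn_affineSpan_basePolytope {V : Type*} [AddCommGroup V] [Module ℝ V]
    {f g : (M.E → ℝ) →ᵃ[ℝ] V}
    (h : ∀ B, M.IsBase B → f (charVec M.E B) = g (charVec M.E B)) :
    EqOn f g (affineSpan ℝ (basePolytope M)) := by
  rw [basePolytope_eq_convexHull, affineSpan_convexHull]
  refine AffineMap.eqOn_affineSpan ?_
  rintro _ ⟨B, hB, rfl⟩
  exact h B hB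

theorem mapsTo_basePolytope {f : (M.E → ℝ) →ᵃ[ℝ] (N.E → ℝ)}
    (h : ∀ B, M.IsBase B → ∃ D, N.IsBase D ∧ f (charVec M.E B) = charVec N.E D) :
    MapsTo f (basePolytope M) (basePolytope N) := by
  rw [basePolytope_eq_convexHull M]
  refine convexHull_min (t := f ⁻¹' basePolytope N) ?_ ((convex_convexHull ℝ _).affine_preimage f)
  rintro _ ⟨B, hB, rfl⟩
  obtain ⟨D, hD, hfD⟩ := h B hB
  rw [mem_preimage, hfD]
  exact charVec_mem_basePolytope hD

variable {ι₁ κ₁ ι₂ κ₂ : Type*} {S₁ : Matrix ι₁ κ₁ ℝ} {x : ι₁} {S₂ : Matrix ι₂ κ₂ ℝ} {y : ι₂}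

namespace Factorization

theorem exists_col₁_eq (F : Factorization M S₁ x S₂ y) (c : κ₁) : ∃ d, S₂ y d = S₁ x c :=
  (F.isSpecialRow₁.1 c).elim (fun h => h ▸ F.isSpecialRow₂.2.1) fun h => h ▸ F.isSpecialRow₂.2.2

variable (F : Factorization M S₁ x S₂ y)

theorem col₁_surjective : Function.Surjective F.col₁ := fun c =>
  let ⟨_, hd⟩ := F.exists_col₁_eq c
  let ⟨B, hB, _⟩ := F.exists_base hd.symm
  ⟨B, hB⟩

/-- A choice of a base for every column of the first factor such that the column of the second
factor depends on the special entry only. -/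
structure IsSection (sec : κ₁ → Base M) : Prop where
  col₁_sec : ∀ c, F.col₁ (sec c) = c
  col₂_sec : ∀ {c c'}, S₁ x c = S₁ x c' → F.col₂ (sec c) = F.col₂ (sec c')

theorem exists_isSection : ∃ sec, F.IsSection sec := by
  have : Nonempty κ₂ := ⟨F.isSpecialRow₂.2.1.choose⟩
  choose sec hsec using fun c =>
    F.exists_base (Function.invFun_eq (F.exists_col₁_eq c)).symm
  exact ⟨sec, fun c => (hsec c).1, fun {c c'} h => by rw [(hsec c).2, (hsec c').2, h]⟩

variable {F} {sec : κ₁ → Base M}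

theorem IsSection.row₂_eq (hsec : F.IsSection sec) (i : ι₂) (c : κ₁) {c₀ c₁ : κ₁}
    (hc₀ : S₁ x c₀ = 0) (hc₁ : S₁ x c₁ = 1) :
    F.row₂ i (charVec M.E (sec c).1) =
      AffineMap.lineMap (S₂ i (F.col₂ (sec c₀))) (S₂ i (F.col₂ (sec c₁))) (S₁ x c) := by
  rw [F.row₂_charVec]
  rcases F.isSpecialRow₁.1 c with h | h
  · rw [h, AffineMap.lineMap_apply_zero, hsec.col₂_sec (h.trans hc₀.symm)]
  · rw [h, AffineMap.lineMap_apply_one, hsec.col₂_sec (h.trans hc₁.symm)]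

/-- On the affine hull of the base polytope of `N`, the rows of the second factor are convex
combinations of their values at a column with special entry `0` and at one with special entry `1`,
and hence redundant. -/
theorem IsSection.isSlackMatrix_addComplRow [N.Finite] (hsec : F.IsSection sec) {w : κ₁ → Set β}
    (hw : range w = {D | N.IsBase D}) {φ : (N.E → ℝ) →ᵃ[ℝ] (M.E → ℝ)}
    (hφ : ∀ c, φ (charVec N.E (w c)) = charVec M.E (sec c).1) {π : (M.E → ℝ) →ᵃ[ℝ] (N.E → ℝ)}
    (hπ : ∀ B : Base M, π (charVec M.E B.1) = charVec N.E (w (F.col₁ B))) :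
    IsSlackMatrix (addComplRow S₁ x) (basePolytope N) := by
  obtain ⟨c₀, hc₀⟩ := F.isSpecialRow₁.2.1
  obtain ⟨c₁, hc₁⟩ := F.isSpecialRow₁.2.2
  have hbase : ∀ {p : Set β → Prop}, (∀ c, p (w c)) → ∀ D, N.IsBase D → p D := fun h D hD => by
    obtain ⟨c, rfl⟩ := hw.superset hD
    exact h c
  have hφφ : ∀ i c, F.row₁ i (φ (charVec N.E (w c))) = S₁ i c := fun i c => by
    rw [hφ, F.row₁_charVec, hsec.col₁_sec]
  have hinj : Function.Injective w := fun c c' h => by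
    have heq : charVec M.E (sec c).1 = charVec M.E (sec c').1 := by rw [← hφ, ← hφ, h]
    rw [← hsec.col₁_sec c, ← hsec.col₁_sec c', Subtype.ext
      (charVec_injOn (sec c).2.subset_ground (sec c').2.subset_ground heq)]
  refine isSlackMatrix_basePolytope hinj hw
    (Sum.elim (fun i => (F.row₁ i).comp φ) fun _ => AffineMap.const ℝ _ 1 - (F.row₁ x).comp φ)
    ?_ ?_ fun z hz hfz => ?_
  · rintro (i | -) c
    · exact (hφφ i c).symm
    · exact congrArg (1 - ·) (hφφ x c).symm
  · refine addComplRow_nonneg (fun i c => ?_) F.isSpecialRow₁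
    obtain ⟨B, rfl⟩ := F.col₁_surjective c
    exact F.nonneg₁ i B
  · have hmaps : MapsTo φ (basePolytope N) (basePolytope M) :=
      mapsTo_basePolytope (hbase fun c => ⟨_, (sec c).2, hφ c⟩)
    have hspan : φ z ∈ affineSpan ℝ (basePolytope M) := by
      have := (affineSpan ℝ (basePolytope N)).mem_map_of_mem φ hz
      rw [AffineSubspace.map_span] at this
      exact affineSpan_mono ℝ hmaps.image_subset this
    have hx₀ : 0 ≤ F.row₁ x (φ z) := hfz (Sum.inl x)
    have hx₁ : F.row₁ x (φ z) ≤ 1 := sub_nonneg.1 (hfz (Sum.inr ()))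
    have hrow₂ : ∀ i, F.row₂ i (φ z) = AffineMap.lineMap (S₂ i (F.col₂ (sec c₀)))
        (S₂ i (F.col₂ (sec c₁))) (F.row₁ x (φ z)) := fun i =>
      eqOn_affineSpan_basePolytope (f := (F.row₂ i).comp φ)
        (g := (AffineMap.lineMap _ _).comp ((F.row₁ x).comp φ)) (hbase fun c => by
          simp only [AffineMap.comp_apply]
          rw [hφφ, hφ, hsec.row₂_eq i c hc₀ hc₁]) hz
    have hmem : φ z ∈ basePolytope M := F.mem_basePolytope _ hspan (fun i => hfz (Sum.inl i))
      fun i => by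
        rw [hrow₂]
        exact (convex_Ici (0 : ℝ)).lineMap_mem (mem_Ici.2 (F.nonneg₂ i _))
          (mem_Ici.2 (F.nonneg₂ i _)) ⟨hx₀, hx₁⟩
    have hπφ : π (φ z) = z :=
      eqOn_affineSpan_basePolytope (f := π.comp φ) (g := AffineMap.id ℝ _) (hbase fun c => by
        simp only [AffineMap.comp_apply, AffineMap.id_apply]
        rw [hφ, hπ, hsec.col₁_sec]) hz
    rw [← hπφ]
    exact mapsTo_basePolytope (f := π)
      (fun B hB => ⟨_, hw.subset ⟨_, rfl⟩, hπ ⟨B, hB⟩⟩) hmem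

end Factorization

variable {N : Matroid (Option α)} {A : Set α} {τ : Set α → Prop}

theorem exists_affineMap_charVec_halfBase (hE : N.E = insert none (some '' A)) (hA : A ⊆ M.E)
    {η : (M.E → ℝ) →ᵃ[ℝ] ℝ}
    (hη₁ : ∀ B, M.IsBase B → τ B → η (charVec M.E B) = 1)
    (hη₀ : ∀ B, M.IsBase B → ¬ τ B → η (charVec M.E B) = 0) :
    ∃ π : (M.E → ℝ) →ᵃ[ℝ] (N.E → ℝ), ∀ B, M.IsBase B →
      π (charVec M.E B) = charVec N.E (halfBase A τ B) := by
  have hsome : ∀ {e}, some e ∈ N.E → e ∈ A := fun he => by simpa [hE] using he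
  refine ⟨AffineMap.pi fun o => match o with
    | ⟨none, _⟩ => η
    | ⟨some e, he⟩ => (LinearMap.proj ⟨e, hA (hsome he)⟩ : (M.E → ℝ) →ₗ[ℝ] ℝ).toAffineMap,
    fun B hB => funext fun o => ?_⟩
  obtain ⟨_ | e, he⟩ := o
  · by_cases hτ : τ B
    · simp [charVec_apply, hτ, hη₁ B hB hτ]
    · simp [charVec_apply, hτ, hη₀ B hB hτ]
  · change charVec M.E B _ = _
    have hmem : some e ∈ halfBase A τ B ↔ e ∈ B := and_iff_left (hsome he)
    simp only [charVec_apply]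
    split_ifs <;> tauto

theorem exists_affineMap_halfBase_charVec (hE : N.E = insert none (some '' A))
    (T : Prop → Set α) : ∃ φ : (N.E → ℝ) →ᵃ[ℝ] (M.E → ℝ), ∀ B, B \ A = T (τ B) →
      φ (charVec N.E (halfBase A τ B)) = charVec M.E B := by
  classical
  have hnone : none ∈ N.E := by simp [hE]
  have hsome : ∀ {e}, e ∈ A → some e ∈ N.E := fun he => by simp [hE, he]
  let proj (o : N.E) : (N.E → ℝ) →ᵃ[ℝ] ℝ := (LinearMap.proj o : (N.E → ℝ) →ₗ[ℝ] ℝ).toAffineMap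
  refine ⟨AffineMap.pi fun e => if he : (e : α) ∈ A then proj ⟨some e, hsome he⟩ else
    (AffineMap.lineMap (charVec M.E (T False) e) (charVec M.E (T True) e)).comp
      (proj ⟨none, hnone⟩),
    fun B hB => funext fun e => ?_⟩
  by_cases he : (e : α) ∈ A
  · simp [proj, he, charVec_apply]
  · have hmem : (e : α) ∈ B ↔ (e : α) ∈ T (τ B) := by rw [← hB, mem_sdiff, and_iff_left he]
    by_cases hτ : τ B <;> simp [proj, he, charVec_apply, hmem, hτ]

theorem Factorization.IsSection.isSlackMatrix_of_isHalf [M.Finite]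
    {F : Factorization M S₁ x S₂ y} {sec : κ₁ → Base M} (hsec : F.IsSection sec)
    (hN : IsHalf N M A τ) (hA : A ⊆ M.E) {η : (M.E → ℝ) →ᵃ[ℝ] ℝ}
    (hη₁ : ∀ B, M.IsBase B → τ B → η (charVec M.E B) = 1)
    (hη₀ : ∀ B, M.IsBase B → ¬ τ B → η (charVec M.E B) = 0)
    (hcol : ∀ B B', F.col₁ B = F.col₁ B' → halfBase A τ B.1 = halfBase A τ B'.1)
    (hτ : Function.FactorsThrough (fun c => (sec c).1 \ A) fun c => τ (sec c)) :
    IsSlackMatrix (addComplRow S₁ x) (basePolytope N) := by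
  have : N.Finite := hN.finite hA
  obtain ⟨hE, hbase⟩ := hN
  obtain ⟨T, hT⟩ := (Function.factorsThrough_iff _).1 hτ
  obtain ⟨φ, hφ⟩ := exists_affineMap_halfBase_charVec (M := M) (τ := τ) hE T
  obtain ⟨π, hπ⟩ := exists_affineMap_charVec_halfBase hE hA hη₁ hη₀
  have hcol' : ∀ B, halfBase A τ (sec (F.col₁ B)).1 = halfBase A τ B.1 := fun B =>
    hcol _ _ (hsec.col₁_sec _)
  refine hsec.isSlackMatrix_addComplRow (w := fun c => halfBase A τ (sec c).1) ?_
    (fun c => hφ _ (congrFun hT c)) fun B => (hπ B B.2).trans (by rw [hcol'])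
  ext D
  rw [mem_ofPred_eq, hbase]
  constructor
  · rintro ⟨c, rfl⟩
    exact ⟨_, (sec c).2, rfl⟩
  · rintro ⟨B, hB, rfl⟩
    exact ⟨_, hcol' ⟨B, hB⟩⟩

end SlackMatrixOfHalf

section TwoSumDecomposition

variable {α ι₁ κ₁ ι₂ κ₂ : Type*} {M : Matroid α} {A : Set α}
  {S₁ : Matrix ι₁ κ₁ ℝ} {x : ι₁} {S₂ : Matrix ι₂ κ₂ ℝ} {y : ι₂}

theorem ncard_inter_ground_sdiff_eq [M.Finite] {B B' : Set α} (hB : M.IsBase B)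
    (hB' : M.IsBase B') (h : (B ∩ A).ncard = (B' ∩ A).ncard) :
    (B ∩ (M.E \ A)).ncard = (B' ∩ (M.E \ A)).ncard := by
  rw [← inter_sdiff_assoc, ← inter_sdiff_assoc, inter_eq_left.2 hB.subset_ground,
    inter_eq_left.2 hB'.subset_ground]
  have := ncard_inter_add_ncard_sdiff_eq_ncard B A hB.finite
  have := ncard_inter_add_ncard_sdiff_eq_ncard B' A hB'.finite
  have := hB.ncard_eq_ncard_of_isBase hB'
  omega

theorem IsSpecialRow.eq_of_eq_iff {ι κ : Type*} {S : Matrix ι κ ℝ} {x : ι} (hx : IsSpecialRow S x)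
    {s : ℝ} (hs : s = 0 ∨ s = 1) {c c' : κ} (h : S x c = s ↔ S x c' = s) : S x c = S x c' := by
  rcases hx.1 c with hc | hc <;> rcases hx.1 c' with hc' | hc' <;> rcases hs with rfl | rfl <;>
    simp_all

theorem IsSpecialRow.ne_iff_eq {ι κ : Type*} {S : Matrix ι κ ℝ} {x : ι} (hx : IsSpecialRow S x)
    {c c₀ c₁ : κ} (hne : S x c₀ ≠ S x c₁) : S x c ≠ S x c₀ ↔ S x c = S x c₁ := by
  rcases hx.1 c with hc | hc <;> rcases hx.1 c₀ with h₀ | h₀ <;> rcases hx.1 c₁ with h₁ | h₁ <;>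
    simp_all

theorem IsExchange.isTwoSplit_sdiff_singleton {B : Set α} {i j : α} (h : IsExchange M B i j) :
    IsTwoSplit M (M.E \ {i}) (i ∈ ·) B i j where
  toIsExchange := h
  subset_ground := sdiff_subset
  isBase_mix D D' hD hD' hi := by
    have := hD.subset_ground
    have := hD'.subset_ground
    have heq : D ∩ (M.E \ {i}) ∪ D' \ (M.E \ {i}) = D := by grind
    rwa [heq]
  notMem_left hi := hi.2 rfl
  mem_right := ⟨h.isBase_exchange.subset_ground (mem_insert _ _), h.ne.symm⟩
  pos := h.mem
  neg := by simp [h.ne]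

theorem IsExchange.exists_halfBase_eq_iff {B : Set α} {i j : α} (h : IsExchange M B i j)
    {D : Set (Option α)} :
    (∃ B, M.IsBase B ∧ halfBase (M.E \ (M.E \ {i})) (i ∉ ·) B = D) ↔ D = {none} ∨ D = {some i} := by
  have hi : i ∈ M.E := h.isBase.subset_ground h.mem
  have hmem : ∀ ⦃B⦄, i ∈ B → halfBase (M.E \ (M.E \ {i})) (i ∉ ·) B = {some i} := fun B hiB => by
    ext (_ | e)
    · simp [hiB]
    · simp only [some_mem_halfBase, mem_singleton_iff, Option.some_inj]
      grind
  have hnotMem : ∀ ⦃B⦄, i ∉ B → halfBase (M.E \ (M.E \ {i})) (i ∉ ·) B = {none} := fun B hiB => by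
    ext (_ | e)
    · simp [hiB]
    · simp only [some_mem_halfBase, mem_singleton_iff, reduceCtorEq]
      grind
  constructor
  · rintro ⟨B, -, rfl⟩
    by_cases hiB : i ∈ B
    exacts [Or.inr (hmem hiB), Or.inl (hnotMem hiB)]
  · rintro (rfl | rfl)
    exacts [⟨_, h.isBase_exchange, hnotMem (by simp [h.ne])⟩, ⟨B, h.isBase, hmem h.mem⟩]

/-- The matroid `M`, viewed in `Option α`, is a 2-sum of two matroids whose base polytopes have the
slack matrices `T₁` and `T₂`. -/
def HasSlackTwoSum {ι₁ ι₂ : Type*} (M : Matroid α) (T₁ : Matrix ι₁ κ₁ ℝ) (T₂ : Matrix ι₂ κ₂ ℝ) :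
    Prop :=
  ∃ M₁ M₂ : Matroid (Option α), IsTwoSum (M.mapEmbedding .some) M₁ M₂ none ∧
    IsSlackMatrix T₁ (basePolytope M₁) ∧ IsSlackMatrix T₂ (basePolytope M₂)

theorem HasSlackTwoSum.symm {ι₁ ι₂ : Type*} {T₁ : Matrix ι₁ κ₁ ℝ} {T₂ : Matrix ι₂ κ₂ ℝ}
    (h : HasSlackTwoSum M T₁ T₂) : HasSlackTwoSum M T₂ T₁ :=
  let ⟨M₁, M₂, hM, h₁, h₂⟩ := h
  ⟨M₂, M₁, hM.symm, h₂, h₁⟩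

namespace Factorization

variable {F : Factorization M S₁ x S₂ y}

/-- The special entry of the column of a base `B` and `|B ∩ A|` determine each other. -/
structure IsSpecialSet (F : Factorization M S₁ x S₂ y) (A : Set α) : Prop where
  subset_ground : A ⊆ M.E
  special_eq_iff : ∀ {B B' : Base M},
    S₁ x (F.col₁ B) = S₁ x (F.col₁ B') ↔ (B.1 ∩ A).ncard = (B'.1 ∩ A).ncard

theorem exists_isSpecialSet [M.Finite] (F : Factorization M S₁ x S₂ y) (hM : IsConnected M) :
    ∃ A, F.IsSpecialSet A := by
  obtain ⟨A, hA, k, hk⟩ := hM.exists_eq_sub_ncard_inter (ξ := F.row₁ x) fun B hB => by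
    rw [F.row₁_charVec x ⟨B, hB⟩]
    exact F.isSpecialRow₁.1 _
  refine ⟨A, hA, fun {B B'} => ?_⟩
  rw [← F.row₁_charVec, ← F.row₁_charVec, hk _ B.2, hk _ B'.2, sub_right_inj, Nat.cast_inj]

namespace IsSpecialSet

theorem swap (hA : F.IsSpecialSet A) : F.swap.IsSpecialSet A where
  subset_ground := hA.subset_ground
  special_eq_iff {B B'} := by
    rw [← hA.special_eq_iff, F.special_eq, F.special_eq]
    rfl

theorem compl [M.Finite] (hA : F.IsSpecialSet A) : F.IsSpecialSet (M.E \ A) where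
  subset_ground := sdiff_subset
  special_eq_iff {B B'} := by
    refine hA.special_eq_iff.trans ⟨ncard_inter_ground_sdiff_eq B.2 B'.2, fun h => ?_⟩
    have := ncard_inter_ground_sdiff_eq B.2 B'.2 h
    rwa [sdiff_sdiff_cancel_left hA.subset_ground] at this

theorem nonempty (hA : F.IsSpecialSet A) : A.Nonempty := by
  obtain ⟨⟨c₀, hc₀⟩, ⟨c₁, hc₁⟩⟩ := F.isSpecialRow₁.2
  obtain ⟨B₀, rfl⟩ := F.col₁_surjective c₀
  obtain ⟨B₁, rfl⟩ := F.col₁_surjective c₁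
  by_contra! hempty
  have := hA.special_eq_iff.2 (show (B₀.1 ∩ A).ncard = (B₁.1 ∩ A).ncard by simp [hempty])
  simp [hc₀, hc₁] at this

variable [M.Finite]

theorem exists_isExchange (hA : F.IsSpecialSet A) (hM : IsConnected M) :
    ∃ B i j, IsExchange M B i j ∧ i ∉ A ∧ j ∈ A := by
  obtain ⟨i, hi, hiA⟩ := hA.compl.nonempty
  obtain ⟨j, hj⟩ := hA.nonempty
  obtain ⟨B, hB⟩ := hM.exists_isExchange hi (hA.subset_ground hj) (ne_of_mem_of_not_mem hj hiA).symm
  exact ⟨B, i, j, hB, hiA, hj⟩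

theorem exchangeSpan_le_dir (hA : F.IsSpecialSet A) (hM : IsConnected M) :
    exchangeSpan M.E A ≤ F.dir₁ ∨ exchangeSpan M.E A ≤ F.dir₂ := by
  classical
  refine exchangeSpan_le_or_le fun i j hi hj hij => ?_
  obtain ⟨B, hB⟩ := hM.exists_isExchange j.2 i.2 (Subtype.coe_ne_coe.2 hij.symm)
  have hcard : (insert (i : α) (B \ {(j : α)}) ∩ A).ncard = (B ∩ A).ncard := by
    rw [insert_inter_of_mem hi, sdiff_inter_right_comm]
    exact ncard_exchange (fun h => hB.notMem h.1) ⟨hB.mem, hj⟩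
  have hspecial : S₁ x (F.col₁ ⟨B, hB.isBase⟩) = S₁ x (F.col₁ ⟨_, hB.isBase_exchange⟩) :=
    hA.special_eq_iff.2 hcard.symm
  rw [← hB.charVec_sub]
  exact (col_eq_or_col_eq_of_eq_insert_sdiff rfl hspecial).symm.imp
    (fun h => F.charVec_sub_mem_dir₁ h.symm) fun h => F.charVec_sub_mem_dir₂ h.symm

end IsSpecialSet

theorem exists_affineMap_charVec_eq (F : Factorization M S₁ x S₂ y) {s : ℝ} (hs : s = 0 ∨ s = 1) :
    ∃ η : (M.E → ℝ) →ᵃ[ℝ] ℝ, ∀ B : Base M, (S₁ x (F.col₁ B) = s → η (charVec M.E B.1) = 1) ∧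
      (S₁ x (F.col₁ B) ≠ s → η (charVec M.E B.1) = 0) := by
  rcases hs with rfl | rfl
  · refine ⟨AffineMap.const ℝ _ 1 - F.row₁ x, fun B => ⟨fun h => ?_, fun h => ?_⟩⟩
    · simp [F.row₁_charVec, h]
    · simp [F.row₁_charVec, (F.isSpecialRow₁.1 _).resolve_left h]
  · refine ⟨F.row₁ x, fun B => ⟨fun h => ?_, fun h => ?_⟩⟩
    · rw [F.row₁_charVec, h]
    · rw [F.row₁_charVec, (F.isSpecialRow₁.1 _).resolve_right h]

/-- The side `A` of the ground set belongs to the first factor, and its complement belongs to the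
second factor. -/
structure IsAligned (F : Factorization M S₁ x S₂ y) (A : Set α) : Prop
    extends F.IsSpecialSet A where
  exchangeSpan_le : exchangeSpan M.E A ≤ F.dir₁
  exchangeSpan_compl_le : exchangeSpan M.E (M.E \ A) ≤ F.dir₂

namespace IsAligned

variable [M.Finite]

theorem swap (h : F.IsAligned A) : F.swap.IsAligned (M.E \ A) where
  toIsSpecialSet := h.toIsSpecialSet.swap.compl
  exchangeSpan_le := h.exchangeSpan_compl_le
  exchangeSpan_compl_le := by
    rw [sdiff_sdiff_cancel_left h.subset_ground]
    exact h.exchangeSpan_le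

theorem inter_eq (h : F.IsAligned A) {B B' : Base M} (hcol : F.col₁ B = F.col₁ B') :
    B.1 ∩ A = B'.1 ∩ A := by
  have : Finite M.E := M.ground_finite
  have hB := B.2.subset_ground
  have hB' := B'.2.subset_ground
  have hcard := h.special_eq_iff.1 (congrArg (S₁ x) hcol)
  have hmem₁ := h.exchangeSpan_le (charVec_inter_sub_mem_exchangeSpan hB hB' hcard)
  have hmem₂ := h.exchangeSpan_compl_le (charVec_inter_sub_mem_exchangeSpan hB hB'
    (ncard_inter_ground_sdiff_eq B.2 B'.2 hcard))
  have hmem := sub_mem (F.charVec_sub_mem_dir₂ hcol) hmem₂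
  rw [← charVec_inter_add_charVec_inter_sdiff M.E A B,
    ← charVec_inter_add_charVec_inter_sdiff M.E A B', add_sub_add_comm, add_sub_cancel_right]
    at hmem
  exact charVec_injOn (inter_subset_left.trans hB) (inter_subset_left.trans hB')
    (sub_eq_zero.1 (Submodule.disjoint_def.1 F.disjoint_dir _ hmem₁ hmem))

theorem sdiff_eq (h : F.IsAligned A) {B B' : Base M} (hcol : F.col₂ B = F.col₂ B') :
    B.1 \ A = B'.1 \ A := by
  have := h.swap.inter_eq hcol
  rwa [← inter_sdiff_assoc, ← inter_sdiff_assoc, inter_eq_left.2 B.2.subset_ground,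
    inter_eq_left.2 B'.2.subset_ground] at this

theorem isTwoSplit (h : F.IsAligned A) {B : Set α} {i j : α} (hB : IsExchange M B i j)
    (hi : i ∉ A) (hj : j ∈ A) :
    IsTwoSplit M A (fun D => (D ∩ A).ncard = (B ∩ A).ncard) B i j where
  toIsExchange := hB
  subset_ground := h.subset_ground
  isBase_mix D D' hD hD' hτ := by
    have hspecial : S₁ x (F.col₁ ⟨D, hD⟩) = S₁ x (F.col₁ ⟨D', hD'⟩) :=
      F.isSpecialRow₁.eq_of_eq_iff (F.isSpecialRow₁.1 (F.col₁ ⟨B, hB.isBase⟩))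
        (by simpa only [h.special_eq_iff])
    obtain ⟨C, hC₁, hC₂⟩ := F.exists_base (hspecial.trans (F.special_eq _))
    have hC : D ∩ A ∪ D' \ A = C := by
      rw [← h.inter_eq hC₁, ← h.sdiff_eq hC₂, inter_union_sdiff]
    exact hC ▸ C.2
  notMem_left := hi
  mem_right := hj
  pos := rfl
  neg := by
    rw [insert_inter_of_mem hj, sdiff_inter_right_comm, sdiff_singleton_eq_self fun h => hi h.2,
      ncard_insert_of_notMem (fun h => hB.notMem h.1) (hB.isBase.finite.inter_of_left A)]
    exact Nat.succ_ne_self _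

theorem isSlackMatrix (h : F.IsAligned A) {N : Matroid (Option α)} {τ : Set α → Prop}
    (hN : IsHalf N M A τ) {s : ℝ} (hs : s = 0 ∨ s = 1)
    (hτ : ∀ B : Base M, τ B.1 ↔ S₁ x (F.col₁ B) = s) :
    IsSlackMatrix (addComplRow S₁ x) (basePolytope N) := by
  obtain ⟨sec, hsec⟩ := F.exists_isSection
  obtain ⟨η, hη⟩ := F.exists_affineMap_charVec_eq hs
  refine hsec.isSlackMatrix_of_isHalf hN h.subset_ground
    (fun B hB hτB => (hη ⟨B, hB⟩).1 ((hτ _).1 hτB))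
    (fun B hB hτB => (hη ⟨B, hB⟩).2 (mt (hτ _).2 hτB)) (fun B B' hcol => ?_) ?_
  · ext (_ | e)
    · simp only [none_mem_halfBase, hτ, hcol]
    · exact Set.ext_iff.1 (h.inter_eq hcol) e
  · intro c c' hcc'
    refine h.sdiff_eq (hsec.col₂_sec (F.isSpecialRow₁.eq_of_eq_iff hs ?_))
    rw [← hsec.col₁_sec c, ← hsec.col₁_sec c', ← hτ, ← hτ]
    exact iff_of_eq hcc'

theorem hasSlackTwoSum (h : F.IsAligned A) (hM : IsConnected M) :
    HasSlackTwoSum M (addComplRow S₁ x) (addComplRow S₂ y) := by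
  obtain ⟨B, i, j, hB, hi, hj⟩ := h.exists_isExchange hM
  have hsplit := h.isTwoSplit hB hi hj
  obtain ⟨M₁, hM₁⟩ := hsplit.exists_isHalf
  obtain ⟨M₂, hM₂⟩ := hsplit.compl.exists_isHalf
  refine ⟨M₁, M₂, hsplit.isTwoSum hM₁ hM₂,
    h.isSlackMatrix hM₁ (F.isSpecialRow₁.1 (F.col₁ ⟨B, hB.isBase⟩))
      fun D => (h.special_eq_iff (B' := ⟨B, hB.isBase⟩)).symm,
    h.swap.isSlackMatrix hM₂ (F.isSpecialRow₂.1 (F.col₂ ⟨_, hB.isBase_exchange⟩)) fun D => ?_⟩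
  have hne : S₁ x (F.col₁ ⟨B, hB.isBase⟩) ≠ S₁ x (F.col₁ ⟨_, hB.isBase_exchange⟩) := fun heq =>
    hsplit.neg (h.special_eq_iff.1 heq.symm)
  have hD := F.isSpecialRow₁.ne_iff_eq (c := F.col₁ D) hne
  rw [ne_eq, h.special_eq_iff] at hD
  rwa [F.special_eq, F.special_eq] at hD

end IsAligned

theorem injective_special_of_exchangeSpan_le [M.Finite] (hA : F.IsSpecialSet A)
    (h : exchangeSpan M.E A ≤ F.dir₁) (hcompl : exchangeSpan M.E (M.E \ A) ≤ F.dir₁) :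
    Function.Injective (S₂ y) := by
  intro d d' hd
  obtain ⟨B, rfl⟩ := F.swap.col₁_surjective d
  obtain ⟨B', hcol, rfl⟩ := F.exists_base ((F.special_eq B).trans hd)
  have : Finite M.E := M.ground_finite
  have hB := B.2.subset_ground
  have hB' := B'.2.subset_ground
  have hcard := hA.special_eq_iff.1 (congrArg (S₁ x) hcol).symm
  have hmem := add_mem (h (charVec_inter_sub_mem_exchangeSpan hB hB' hcard))
    (hcompl (charVec_inter_sub_mem_exchangeSpan hB hB'
      (ncard_inter_ground_sdiff_eq B.2 B'.2 hcard)))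
  rw [← add_sub_add_comm, charVec_inter_add_charVec_inter_sdiff,
    charVec_inter_add_charVec_inter_sdiff] at hmem
  have heq := Submodule.disjoint_def.1 F.disjoint_dir _ hmem (F.charVec_sub_mem_dir₂ hcol.symm)
  rw [Subtype.ext (charVec_injOn hB hB' (sub_eq_zero.1 heq))]
  rfl

theorem hasSlackTwoSum_of_injective [M.Finite] (F : Factorization M S₁ x S₂ y) {B : Set α} {i j : α}
    (hB : IsExchange M B i j) (hinj : Function.Injective (S₂ y)) :
    HasSlackTwoSum M (addComplRow S₁ x) (addComplRow S₂ y) := by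
  have hsplit := hB.isTwoSplit_sdiff_singleton
  obtain ⟨M₁, hM₁⟩ := hsplit.exists_isHalf
  obtain ⟨M₂, hM₂⟩ := hsplit.compl.exists_isHalf
  refine ⟨M₁, M₂, hsplit.isTwoSum hM₁ hM₂, ?_, ?_⟩
  · obtain ⟨sec, hsec⟩ := F.exists_isSection
    have hi : i ∈ M.E := hB.isBase.subset_ground hB.mem
    refine hsec.isSlackMatrix_of_isHalf hM₁ sdiff_subset
      (η := (LinearMap.proj ⟨i, hi⟩ : (M.E → ℝ) →ₗ[ℝ] ℝ).toAffineMap)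
      (fun D _ hiD => by simp [charVec_apply, hiD]) (fun D _ hiD => by simp [charVec_apply, hiD])
      (fun D D' hcol => ?_) fun c c' hcc' => ?_
    · have hspecial : S₂ y (F.col₂ D) = S₂ y (F.col₂ D') := by
        rw [← F.special_eq, ← F.special_eq, hcol]
      rw [F.eq_of_col_eq hcol (hinj hspecial)]
    · have := (sec c).2.subset_ground
      have := (sec c').2.subset_ground
      grind
  · have : M₂.Finite := hM₂.finite sdiff_subset
    refine isSlackMatrix_addComplRow_of_injective (fun k d => ?_) F.isSpecialRow₂ hinj
      (D₀ := {none}) (D₁ := {some i}) (by simp) fun D => ?_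
    · obtain ⟨B, rfl⟩ := F.swap.col₁_surjective d
      exact F.nonneg₂ k B
    · rw [hM₂.2, hB.exists_halfBase_eq_iff]

theorem hasSlackTwoSum [M.Finite] (F : Factorization M S₁ x S₂ y) (hM : IsConnected M) :
    HasSlackTwoSum M (addComplRow S₁ x) (addComplRow S₂ y) := by
  obtain ⟨A, hA⟩ := F.exists_isSpecialSet hM
  obtain ⟨B, i, j, hB, -⟩ := hA.exists_isExchange hM
  rcases hA.exchangeSpan_le_dir hM with h | h <;>
    rcases hA.compl.exchangeSpan_le_dir hM with h' | h'
  · exact F.hasSlackTwoSum_of_injective hB (injective_special_of_exchangeSpan_le hA h h')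
  · exact IsAligned.hasSlackTwoSum ⟨hA, h, h'⟩ hM
  · exact (IsAligned.hasSlackTwoSum (F := F.swap) ⟨hA.swap, h, h'⟩ hM).symm
  · exact (F.swap.hasSlackTwoSum_of_injective hB
      (injective_special_of_exchangeSpan_le hA.swap h h')).symm

end Factorization

end TwoSumDecomposition

end TwoProd

theorem lemma4p4_general {α ι κ ι₁ κ₁ ι₂ κ₂ : Type*}
    (M : Matroid α) [M.Finite] (hM : TwoProd.IsConnected M)
    (S : Matrix ι κ ℝ) (hS : TwoProd.IsSlackMatrix S (TwoProd.basePolytope M))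
    (S₁ : Matrix ι₁ κ₁ ℝ) (x₁ : ι₁) (S₂ : Matrix ι₂ κ₂ ℝ) (y₁ : ι₂)
    (hprod : TwoProd.IsTwoProduct S S₁ x₁ S₂ y₁) :
    ∃ M₁ M₂ : Matroid (Option α),
      TwoProd.IsTwoSum (M.mapEmbedding Function.Embedding.some) M₁ M₂ none ∧
      TwoProd.IsSlackMatrix (TwoProd.addComplRow S₁ x₁) (TwoProd.basePolytope M₁) ∧
      TwoProd.IsSlackMatrix (TwoProd.addComplRow S₂ y₁) (TwoProd.basePolytope M₂) := by
  obtain ⟨F⟩ := hS.nonempty_factorization hprod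
  exact F.hasSlackTwoSum hM

/-- The matroid `M` is viewed in `Option α`, so that `none` serves as the new element `p ∉ E`. -/
theorem lemma4p4 {α ι κ ι₁ κ₁ ι₂ κ₂ : Type*}
    [Finite ι] [Finite κ] [Finite ι₁] [Finite κ₁] [Finite ι₂] [Finite κ₂]
    (M : Matroid α) [M.Finite] (hM : TwoProd.IsConnected M)
    (S : Matrix ι κ ℝ) (hS : TwoProd.IsSlackMatrix S (TwoProd.basePolytope M))
    (S₁ : Matrix ι₁ κ₁ ℝ) (x₁ : ι₁) (S₂ : Matrix ι₂ κ₂ ℝ) (y₁ : ι₂)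
    (hprod : TwoProd.IsTwoProduct S S₁ x₁ S₂ y₁) :
    ∃ M₁ M₂ : Matroid (Option α),
      TwoProd.IsTwoSum (M.mapEmbedding Function.Embedding.some) M₁ M₂ none ∧
      TwoProd.IsSlackMatrix (TwoProd.addComplRow S₁ x₁) (TwoProd.basePolytope M₁) ∧
      TwoProd.IsSlackMatrix (TwoProd.addComplRow S₂ y₁) (TwoProd.basePolytope M₂) :=
  lemma4p4_general M hM S hS S₁ x₁ S₂ y₁ hprod
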